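/- Let $n\ge 0$ and $\hbar>0$. For $\psi\in\mathcal S'(\mathbb R^n)$ and $\phi\in\mathcal S(\mathbb R^n)$ let $$W(\psi,\phi)(x,p)=\left(\tfrac1{2\pi\hbar}\right)^n\int_{\mathbb R^n}e^{-\frac i\hbar p\cdot y}\,\psi(x+\tfrac12y)\,\overline{\phi(x-\tfrac12y)}\,dy ,\qquad (x,p)\in\mathbb R^{2n},$$ be the cross-Wigner transform (the integral being understood, after the substitution $u=x+\frac12y$, as the pairing of the tempered distribution $\psi$ with a Schwartz function). The Feichtinger algebra $S_0(\mathbb R^n)$ is the set of all $\psi\in\mathcal S'(\mathbb R^n)$ such that $W(\psi,\phi)\in L^1(\mathbb R^{2n})$ for every $\phi\in\mathcal S(\mathbb R^n)$, $\phi\neq0$. For a real quadratic form $W(x,x')=\frac12Px\cdot x-Lx\cdot x'+\frac12Qx'\cdot x'$ with $P=P^T$, $Q=Q^T$, $\det L\ne0$, and an integer $m$ such that $m\pi$ is an argument of $\det L$, let $\widehat S_{W,m}$ be the unitary operator on $L^2(\mathbb R^n)$ given on $\mathcal S(\mathbb R^n)$ by $$\widehat S_{W,m}\psi(x)=\left(\tfrac1{2\pi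 i\hbar}\right)^{n/2}i^m\sqrt{|\det L|}\int_{\mathbb R^n}e^{\frac i\hbar W(x,x')}\psi(x')\,dx'\qquad(\arg i=\pi/2).$$ For $(x_0,p_0)\in\mathbb R^{2n}$ let $\widehat T(x_0,p_0)\psi(x)=e^{\frac i\hbar(p_0\cdot x-\frac12p_0\cdot x_0)}\psi(x-x_0)$ on $L^2(\mathbb R^n)$. Let $\mathrm{Mp}(n)$ be the group of unitary operators on $L^2(\mathbb R^n)$ generated by all the $\widehat S_{W,m}$, and let $\mathrm{IMp}(n)$ be the group generated by $\mathrm{Mp}(n)$ and all the $\widehat T(x_0,p_0)$. Then $S_0(\mathbb R^n)$ is closed under the action of $\mathrm{IMp}(n)$: one has $S_0(\mathbb R^n)\subset L^2(\mathbb R^n)$, and $U\psi\in S_0(\mathbb R^n)$ for every $U\in\mathrm{IMp}(n)$ and every $\psi\in S_0(\mathbb R^n)$. -/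

import Mathlib

open MeasureTheory SchwartzMap
open scoped Matrix ENNReal ComplexConjugate

noncomputable section

namespace Feichtinger

/-- Configuration space `ℝⁿ` with its Euclidean structure. -/
abbrev Config (n : ℕ) : Type := EuclideanSpace ℝ (Fin n)

/-- The Hilbert space `L²(ℝⁿ)` of complex-valued functions. -/
abbrev L2 (n : ℕ) : Type := Lp ℂ 2 (volume : Measure (Config n))

/-! ### Unimodular phases have temperate growth -/

lemma hasTemperateGrowth_cexp_real :
    Function.HasTemperateGrowth (fun t : ℝ => Complex.exp (Complex.I * t)) := by
  have hs : ContDiff ℝ ((⊤ : ℕ∞) : WithTop ℕ∞) (fun t : ℝ => Complex.exp (Complex.I * t)) :=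
    Complex.contDiff_exp.comp (contDiff_const.mul Complex.ofRealCLM.contDiff)
  have hd : ∀ n : ℕ, iteratedDeriv n (fun t : ℝ => Complex.exp (Complex.I * t)) =
      fun t : ℝ => Complex.I ^ n * Complex.exp (Complex.I * t) := by
    intro n
    induction n with
    | zero => simp
    | succ k ih =>
      rw [iteratedDeriv_succ, ih]
      funext t
      have h1 : HasDerivAt (fun t : ℝ => Complex.I * (t : ℂ)) (Complex.I * 1) t :=
        (Complex.ofRealCLM.hasDerivAt (x := t)).const_mul Complex.I
      have h2 := (h1.cexp).const_mul (Complex.I ^ k)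
      rw [h2.deriv]
      ring
  refine ⟨hs, fun n => ⟨0, 1, fun t => ?_⟩⟩
  rw [norm_iteratedFDeriv_eq_norm_iteratedDeriv, hd n]
  simp [mul_comm Complex.I, Complex.norm_exp_ofReal_mul_I]

lemma hasTemperateGrowth_phase {n : ℕ} {θ : Config n → ℝ} (hθ : θ.HasTemperateGrowth) :
    Function.HasTemperateGrowth (fun u => Complex.exp (Complex.I * (θ u : ℂ))) :=
  hasTemperateGrowth_cexp_real.comp hθ

/-! ### The cross-Wigner transform and the Feichtinger algebra -/

/-- The phase `u ↦ -(2/ħ) p·(u - x)`. -/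
def wignerPhase (n : ℕ) (ħ : ℝ) (z : Config n × Config n) (u : Config n) : ℝ :=
  -(2 / ħ) * inner ℝ z.2 (u - z.1)

lemma wignerPhase_hasTemperateGrowth (n : ℕ) (ħ : ℝ) (z : Config n × Config n) :
    (wignerPhase n ħ z).HasTemperateGrowth := by
  have h1 : (fun u : Config n => u - z.1).HasTemperateGrowth := by fun_prop
  have h2 : (fun u : Config n => inner ℝ z.2 (u - z.1)).HasTemperateGrowth :=
    ((innerSL ℝ z.2).hasTemperateGrowth).comp h1
  exact (Function.HasTemperateGrowth.const (-(2 / ħ))).mul h2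

/-- The Schwartz function `u ↦ conj (φ (2x - u))`. -/
def reflectedWindow {n : ℕ} (φ : 𝓢(Config n, ℂ)) (x : Config n) : 𝓢(Config n, ℂ) :=
  postcompCLM (𝕜 := ℝ) (Complex.conjCLE : ℂ →L[ℝ] ℂ)
    (compSubConstCLM ℝ ((2 : ℝ) • x)
      (compCLMOfContinuousLinearEquiv ℝ (ContinuousLinearEquiv.neg ℝ) φ))

/-- The Schwartz function `u ↦ exp (-(2i/ħ) p·(u - x)) * conj (φ (2x - u))`, against which a
distribution is evaluated to get its cross-Wigner transform at `z = (x, p)`. -/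
def wignerTest {n : ℕ} (ħ : ℝ) (φ : 𝓢(Config n, ℂ)) (z : Config n × Config n) :
    𝓢(Config n, ℂ) :=
  smulLeftCLM ℂ (fun u => Complex.exp (Complex.I * (wignerPhase n ħ z u : ℂ)))
    (reflectedWindow φ z.1)

lemma wignerTest_apply {n : ℕ} (ħ : ℝ) (φ : 𝓢(Config n, ℂ)) (z : Config n × Config n)
    (u : Config n) :
    wignerTest ħ φ z u = Complex.exp (Complex.I * ((-(2 / ħ) * inner ℝ z.2 (u - z.1) : ℝ) : ℂ)) *
      conj (φ ((2 : ℝ) • z.1 - u)) := by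
  rw [wignerTest, smulLeftCLM_apply_apply
    (hasTemperateGrowth_phase (wignerPhase_hasTemperateGrowth n ħ z))]
  simp [reflectedWindow, wignerPhase]

/-- The cross-Wigner transform of a tempered distribution `ψ` with a Schwartz window `φ`,
`W(ψ, φ)(x, p) = (2πħ)⁻ⁿ ∫ exp (-(i/ħ) p·y) ψ(x + y/2) conj (φ(x - y/2)) dy`.
The integral is read, after the substitution `u = x + y/2`, as the pairing of `ψ` with a Schwartz
function (see `crossWigner_eq_integral`). -/
def crossWigner {n : ℕ} (ħ : ℝ) (ψ : 𝓢'(Config n, ℂ)) (φ : 𝓢(Config n, ℂ))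
    (z : Config n × Config n) : ℂ :=
  ((1 / (2 * Real.pi * ħ) : ℝ) : ℂ) ^ n * (2 ^ n * ψ (wignerTest ħ φ z))

/-- For `ψ ∈ L²(ℝⁿ)` the cross-Wigner transform is given by the usual integral. -/
theorem crossWigner_eq_integral {n : ℕ} (ħ : ℝ) (f : L2 n) (φ : 𝓢(Config n, ℂ))
    (x p : Config n) :
    crossWigner ħ (f : 𝓢'(Config n, ℂ)) φ (x, p) = ((1 / (2 * Real.pi * ħ) : ℝ) : ℂ) ^ n *
      ∫ y : Config n, Complex.exp (-(Complex.I / ħ) * ((inner ℝ p y : ℝ) : ℂ)) *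
        f (x + (1 / 2 : ℝ) • y) * conj (φ (x - (1 / 2 : ℝ) • y)) := by
  rw [crossWigner, Lp.toTemperedDistribution_apply]
  congr 1
  set G : Config n → ℂ := fun u => wignerTest ħ φ (x, p) u • f u with hG
  have h1 : ∀ y : Config n, Complex.exp (-(Complex.I / ħ) * ((inner ℝ p y : ℝ) : ℂ)) *
        f (x + (1 / 2 : ℝ) • y) * conj (φ (x - (1 / 2 : ℝ) • y)) =
        (fun v => G (x + v)) ((1 / 2 : ℝ) • y) := by
    intro y
    simp only [hG, wignerTest_apply, smul_eq_mul]
    have e1 : (2 : ℝ) • x - (x + (1 / 2 : ℝ) • y) = x - (1 / 2 : ℝ) • y := by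
      rw [two_smul]; abel
    have e2 : Complex.I * ((-(2 / ħ) * inner ℝ p (x + (1 / 2 : ℝ) • y - x) : ℝ) : ℂ) =
        -(Complex.I / ħ) * ((inner ℝ p y : ℝ) : ℂ) := by
      rw [add_sub_cancel_left, inner_smul_right]
      push_cast
      ring
    rw [e1, e2]
    ring
  simp_rw [h1]
  rw [Measure.integral_comp_smul volume (fun v => G (x + v)) (1 / 2 : ℝ),
    integral_add_left_eq_self G x]
  simp

/-- The Feichtinger algebra `S₀(ℝⁿ)`: the tempered distributions `ψ` such that
`W(ψ, φ) ∈ L¹(ℝ²ⁿ)` for every nonzero Schwartz window `φ`. -/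
def feichtingerAlgebra (n : ℕ) (ħ : ℝ) : Submodule ℂ 𝓢'(Config n, ℂ) where
  carrier := {ψ | ∀ φ : 𝓢(Config n, ℂ), φ ≠ 0 →
    Integrable (crossWigner ħ ψ φ) (volume : Measure (Config n × Config n))}
  zero_mem' := by
    intro φ _
    have h : crossWigner ħ (0 : 𝓢'(Config n, ℂ)) φ = fun _ => 0 := by
      funext z; simp [crossWigner]
    rw [h]
    exact integrable_zero _ _ _
  add_mem' := by
    intro a b ha hb φ hφ
    have h : crossWigner ħ (a + b) φ = crossWigner ħ a φ + crossWigner ħ b φ := by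
      funext z; simp [crossWigner]; ring
    rw [h]
    exact (ha φ hφ).add (hb φ hφ)
  smul_mem' := by
    intro c a ha φ hφ
    have h : crossWigner ħ (c • a) φ = c • crossWigner ħ a φ := by
      funext z; simp [crossWigner]; ring
    rw [h]
    exact (ha φ hφ).smul c

/-! ### Quadratic Fourier transforms, Heisenberg–Weyl operators -/

/-- The data of a real quadratic form `W(x, x') = ½ P x² - L x·x' + ½ Q x'²` with `P`, `Q`
symmetric and `det L ≠ 0`. -/
structure GeneratingForm (n : ℕ) where
  /-- the coefficient of `x²` -/
  P : Matrix (Fin n) (Fin n) ℝ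
  /-- the coefficient of the mixed term -/
  L : Matrix (Fin n) (Fin n) ℝ
  /-- the coefficient of `x'²` -/
  Q : Matrix (Fin n) (Fin n) ℝ
  symm_P : P.IsSymm
  symm_Q : Q.IsSymm
  det_L_ne_zero : L.det ≠ 0

/-- The value `W(x, x')`. -/
def GeneratingForm.eval {n : ℕ} (W : GeneratingForm n) (x x' : Config n) : ℝ :=
  1 / 2 * ((W.P *ᵥ x.ofLp) ⬝ᵥ x.ofLp) - (W.L *ᵥ x.ofLp) ⬝ᵥ x'.ofLp
    + 1 / 2 * ((W.Q *ᵥ x'.ofLp) ⬝ᵥ x'.ofLp)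

/-- The integer `m` corresponds to a choice of the argument of `det L`: `mπ` is an argument of
`det L`, that is `det L = (-1)ᵐ |det L|`. -/
def GeneratingForm.IsMaslovIndex {n : ℕ} (W : GeneratingForm n) (m : ℤ) : Prop :=
  W.L.det = (-1 : ℝ) ^ m * |W.L.det|

/-- The function `(2πiħ)^(-n/2) iᵐ √|det L| ∫ exp ((i/ħ) W(x, x')) ψ(x') dx'`, with
`arg i = π/2`. -/
def quadraticFourierIntegral {n : ℕ} (ħ : ℝ) (W : GeneratingForm n) (m : ℤ)
    (ψ : 𝓢(Config n, ℂ)) (x : Config n) : ℂ :=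
  (1 / (2 * Real.pi * Complex.I * ħ)) ^ ((n : ℂ) / 2) *
    (Complex.I ^ m * (Real.sqrt |W.L.det| : ℂ)) *
    ∫ x' : Config n, Complex.exp (Complex.I / ħ * (W.eval x x' : ℂ)) * ψ x'

/-- The unitary operator `U` on `L²(ℝⁿ)` is the quadratic Fourier transform `Ŝ_{W,m}`: it is given
by the integral formula on Schwartz functions (a dense subspace, so this determines `U`). -/
def IsQuadraticFourierTransform {n : ℕ} (ħ : ℝ) (W : GeneratingForm n) (m : ℤ)
    (U : L2 n ≃ₗᵢ[ℂ] L2 n) : Prop :=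
  ∀ ψ : 𝓢(Config n, ℂ), U (ψ.toLp 2) =ᵐ[volume] quadraticFourierIntegral ħ W m ψ

/-- The unitary operator `U` on `L²(ℝⁿ)` is the Heisenberg–Weyl operator `T̂(z₀)`,
`z₀ = (x₀, p₀)`: `T̂(z₀)ψ(x) = exp ((i/ħ)(p₀·x - ½ p₀·x₀)) ψ(x - x₀)`. -/
def IsHeisenbergWeyl {n : ℕ} (ħ : ℝ) (z₀ : Config n × Config n)
    (U : L2 n ≃ₗᵢ[ℂ] L2 n) : Prop :=
  ∀ ψ : L2 n, U ψ =ᵐ[volume] fun x =>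
    Complex.exp (Complex.I / ħ * ((inner ℝ z₀.2 x - 1 / 2 * inner ℝ z₀.2 z₀.1 : ℝ) : ℂ)) *
      ψ (x - z₀.1)

/-! ### The generating operators exist -/

lemma eLpNorm_weighted {n : ℕ} (A : Config n ≃L[ℝ] Config n) (a : Config n) (g : Config n → ℂ)
    (hn : ∀ x, ‖g x‖ = Real.sqrt |LinearMap.det (A : Config n →ₗ[ℝ] Config n)|)
    (f : Config n → ℂ) (hf : AEStronglyMeasurable f volume) :
    eLpNorm (fun x => g x * f (A x + a)) 2 volume = eLpNorm f 2 volume := by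
  set d := LinearMap.det (A : Config n →ₗ[ℝ] Config n) with hd
  have hd0 : d ≠ 0 := (LinearEquiv.isUnit_det' A.toLinearEquiv).ne_zero
  have hmap : Measure.map (fun x => A x + a) (volume : Measure (Config n)) =
      ENNReal.ofReal |d⁻¹| • volume := by
    have h1 : (fun x => A x + a) = (fun y => y + a) ∘ A := rfl
    rw [h1, ← Measure.map_map (by fun_prop) A.continuous.measurable]
    have h2 : Measure.map A (volume : Measure (Config n)) = ENNReal.ofReal |d⁻¹| • volume :=
      Measure.map_linearMap_addHaar_eq_smul_addHaar volume
        (f := (A : Config n →ₗ[ℝ] Config n)) hd0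
    rw [h2, Measure.map_smul, (measurePreserving_add_right volume a).map_eq]
  have h3 : eLpNorm (fun x => g x * f (A x + a)) 2 volume =
      eLpNorm (Real.sqrt |d| • (f ∘ fun x => A x + a)) 2 volume := by
    apply eLpNorm_congr_norm_ae
    refine Filter.Eventually.of_forall fun x => ?_
    simp [hn, abs_of_nonneg (Real.sqrt_nonneg _)]
  have hT : Measurable (fun x : Config n => A x + a) := by fun_prop
  rw [h3, eLpNorm_const_smul, ← eLpNorm_map_measure _ hT.aemeasurable, hmap,
    eLpNorm_smul_measure_of_ne_top (by simp), smul_eq_mul, ← mul_assoc]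
  · have : ‖Real.sqrt |d|‖ₑ * ENNReal.ofReal |d⁻¹| ^ (1 / (2 : ℝ≥0∞)).toReal = 1 := by
      have hs : 0 < |d| := abs_pos.mpr hd0
      rw [Real.enorm_eq_ofReal (Real.sqrt_nonneg _), ENNReal.ofReal_rpow_of_pos (by positivity),
        ← ENNReal.ofReal_mul (Real.sqrt_nonneg _), abs_inv]
      have : Real.sqrt |d| * |d|⁻¹ ^ (1 / (2 : ℝ≥0∞)).toReal = 1 := by
        have e : (1 / (2 : ℝ≥0∞)).toReal = 1 / 2 := by simp
        rw [e, ← Real.sqrt_eq_rpow, Real.sqrt_inv]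
        exact mul_inv_cancel₀ (Real.sqrt_pos.mpr hs).ne'
      rw [this]; simp
    rw [this, one_mul]
  · rw [hmap]
    exact hf.smul_measure _

lemma quasi_affine {n : ℕ} (A : Config n ≃L[ℝ] Config n) (a : Config n) :
    Measure.QuasiMeasurePreserving (fun x => A x + a) (volume : Measure (Config n)) volume := by
  have h1 : Measure.QuasiMeasurePreserving A (volume : Measure (Config n)) volume := by
    refine ⟨A.continuous.measurable, ?_⟩
    have h2 := Measure.map_linearMap_addHaar_eq_smul_addHaar (volume : Measure (Config n))
        (f := (A : Config n →ₗ[ℝ] Config n)) (LinearEquiv.isUnit_det' A.toLinearEquiv).ne_zero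
    have h3 : Measure.map A (volume : Measure (Config n)) = _ := h2
    rw [h3]
    exact Measure.smul_absolutelyContinuous
  exact (measurePreserving_add_right volume a).quasiMeasurePreserving.comp h1

theorem exists_weighted {n : ℕ} (A : Config n ≃L[ℝ] Config n) (a : Config n)
    (g : Config n → ℂ) (hg : Continuous g)
    (hn : ∀ x, ‖g x‖ = Real.sqrt |LinearMap.det (A : Config n →ₗ[ℝ] Config n)|) :
    ∃ U : L2 n ≃ₗᵢ[ℂ] L2 n, ∀ f : L2 n, U f =ᵐ[volume] fun x => g x * f (A x + a) := by
  have hd0 : LinearMap.det (A : Config n →ₗ[ℝ] Config n) ≠ 0 :=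
    (LinearEquiv.isUnit_det' A.toLinearEquiv).ne_zero
  have hg0 : ∀ x, g x ≠ 0 := fun x => by
    rw [← norm_pos_iff, hn]; exact Real.sqrt_pos.mpr (abs_pos.mpr hd0)
  have hq := quasi_affine A a
  have hm : ∀ f : L2 n, MemLp (fun x => g x * f (A x + a)) 2 volume := fun f =>
    ⟨hg.aestronglyMeasurable.mul ((Lp.aestronglyMeasurable f).comp_quasiMeasurePreserving hq), by
      rw [eLpNorm_weighted A a g hn f (Lp.aestronglyMeasurable f)]; exact Lp.eLpNorm_lt_top f⟩
  let V : L2 n →ₗᵢ[ℂ] L2 n :=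
    { toFun := fun f => (hm f).toLp _
      map_add' := by
        intro f h
        rw [← MemLp.toLp_add]
        apply MemLp.toLp_congr
        filter_upwards [hq.ae_eq_comp (Lp.coeFn_add f h)] with x hx
        simp only [Function.comp] at hx
        simp only [Pi.add_apply, hx, mul_add]
      map_smul' := by
        intro c f
        rw [RingHom.id_apply, ← MemLp.toLp_const_smul]
        apply MemLp.toLp_congr
        filter_upwards [hq.ae_eq_comp (Lp.coeFn_smul c f)] with x hx
        simp only [Function.comp] at hx
        simp only [Pi.smul_apply, hx, smul_eq_mul]
        ring
      norm_map' := by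
        intro f
        change ‖(hm f).toLp _‖ = ‖f‖
        rw [Lp.norm_toLp, eLpNorm_weighted A a g hn f (Lp.aestronglyMeasurable f), Lp.norm_def] }
  have hV : ∀ f : L2 n, V f =ᵐ[volume] fun x => g x * f (A x + a) := fun f => (hm f).coeFn_toLp
  have hsurj : Function.Surjective V := by
    intro h
    have hq' : Measure.QuasiMeasurePreserving (fun y => A.symm y + -(A.symm a))
        (volume : Measure (Config n)) volume := quasi_affine A.symm _
    set k : Config n → ℂ := fun y => (g (A.symm y + -(A.symm a)))⁻¹ * h (A.symm y + -(A.symm a))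
      with hk
    have hkm : AEStronglyMeasurable k volume :=
      ((hg.inv₀ hg0).comp (by fun_prop : Continuous fun y => A.symm y + -(A.symm a))
        ).aestronglyMeasurable.mul ((Lp.aestronglyMeasurable h).comp_quasiMeasurePreserving hq')
    have hkh : (fun x => g x * k (A x + a)) = h := by
      funext x
      simp [hk, hg0 x]
    have hkL : MemLp k 2 volume :=
      ⟨hkm, by rw [← eLpNorm_weighted A a g hn k hkm, hkh]; exact Lp.eLpNorm_lt_top h⟩
    refine ⟨hkL.toLp k, Lp.ext ?_⟩
    filter_upwards [hV (hkL.toLp k), hq.ae_eq_comp hkL.coeFn_toLp] with x h1 h2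
    simp only [Function.comp] at h2
    rw [h1, h2]
    exact congrFun hkh x
  exact ⟨LinearIsometryEquiv.ofSurjective V hsurj, fun f => hV f⟩

/-- Every Heisenberg–Weyl operator exists as a unitary operator. -/
theorem exists_isHeisenbergWeyl {n : ℕ} (ħ : ℝ) (z₀ : Config n × Config n) :
    ∃ U : L2 n ≃ₗᵢ[ℂ] L2 n, IsHeisenbergWeyl ħ z₀ U := by
  obtain ⟨U, hU⟩ := exists_weighted (n := n) (ContinuousLinearEquiv.refl ℝ _) (-z₀.1)
    (fun x => Complex.exp (Complex.I / ħ *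
      ((inner ℝ z₀.2 x - 1 / 2 * inner ℝ z₀.2 z₀.1 : ℝ) : ℂ))) (by fun_prop) (by
        intro x
        have : Complex.I / ħ * ((inner ℝ z₀.2 x - 1 / 2 * inner ℝ z₀.2 z₀.1 : ℝ) : ℂ) =
          (((inner ℝ z₀.2 x - 1 / 2 * inner ℝ z₀.2 z₀.1) / ħ : ℝ) : ℂ) * Complex.I := by
          push_cast; ring
        rw [this, Complex.norm_exp_ofReal_mul_I]
        have h : LinearMap.det ((ContinuousLinearEquiv.refl ℝ (Config n) :
          Config n ≃L[ℝ] Config n) : Config n →ₗ[ℝ] Config n) = 1 := LinearMap.det_id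
        rw [h]; simp)
  exact ⟨U, fun f => by simpa [sub_eq_add_neg] using hU f⟩

lemma quadratic_hasTemperateGrowth {n : ℕ} (M : Matrix (Fin n) (Fin n) ℝ) (c : ℝ) :
    Function.HasTemperateGrowth (fun x : Config n => c * ((M *ᵥ x.ofLp) ⬝ᵥ x.ofLp)) := by
  have h : (fun x : Config n => c * ((M *ᵥ x.ofLp) ⬝ᵥ x.ofLp)) =
      fun x => c * inner ℝ x (LinearMap.toContinuousLinearMap (Matrix.toLpLin 2 2 M) x) := by
    funext x
    simp [EuclideanSpace.inner_eq_star_dotProduct]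
  rw [h]
  have hT := (LinearMap.toContinuousLinearMap (Matrix.toLpLin 2 2 M)).hasTemperateGrowth
  exact (Function.HasTemperateGrowth.const c).mul
    ((innerSL ℝ).bilinear_hasTemperateGrowth .id' hT)

set_option maxHeartbeats 1000000 in
/-- Every quadratic Fourier transform exists as a unitary operator. -/
theorem exists_isQuadraticFourierTransform {n : ℕ} (ħ : ℝ) (hħ : 0 < ħ) (W : GeneratingForm n)
    (m : ℤ) : ∃ U : L2 n ≃ₗᵢ[ℂ] L2 n, IsQuadraticFourierTransform ħ W m U := by
  have hQ := quadratic_hasTemperateGrowth W.Q (1 / (2 * ħ))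
  have hP := quadratic_hasTemperateGrowth W.P (1 / (2 * ħ))
  have hnorm : ∀ t : ℝ, ‖Complex.exp (Complex.I * (t : ℂ))‖ = 1 := fun t => by
    rw [mul_comm, Complex.norm_exp_ofReal_mul_I]
  obtain ⟨U₂, hU₂⟩ := exists_weighted (n := n) (ContinuousLinearEquiv.refl ℝ _) 0
    (fun x => Complex.exp (Complex.I * ((1 / (2 * ħ) * ((W.Q *ᵥ x.ofLp) ⬝ᵥ x.ofLp) : ℝ) : ℂ)))
    (hasTemperateGrowth_phase hQ).1.continuous (by
      intro x
      have h : LinearMap.det ((ContinuousLinearEquiv.refl ℝ (Config n) :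
          Config n ≃L[ℝ] Config n) : Config n →ₗ[ℝ] Config n) = 1 := LinearMap.det_id
      rw [h, hnorm]; simp)
  let B : Config n →ₗ[ℝ] Config n := (2 * Real.pi * ħ)⁻¹ • Matrix.toLpLin 2 2 W.L
  have hpos : 0 < 2 * Real.pi * ħ := by positivity
  have hBdet : LinearMap.det B = ((2 * Real.pi * ħ)⁻¹) ^ n * W.L.det := by
    rw [LinearMap.det_smul, LinearMap.det_toLpLin]; simp
  have hB0 : LinearMap.det B ≠ 0 := by
    rw [hBdet]; exact mul_ne_zero (by positivity) W.det_L_ne_zero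
  let A : Config n ≃L[ℝ] Config n :=
    (LinearEquiv.ofIsUnitDet (f := B) (v := (EuclideanSpace.basisFun (Fin n) ℝ).toBasis)
      (v' := (EuclideanSpace.basisFun (Fin n) ℝ).toBasis)
      (by rw [LinearMap.det_toMatrix]; exact hB0.isUnit)).toContinuousLinearEquiv
  have hA : ∀ x, A x = B x := fun x => rfl
  have hAB : (A : Config n →ₗ[ℝ] Config n) = B := by ext x; rfl
  set c : ℂ := (1 / (2 * Real.pi * Complex.I * ħ)) ^ ((n : ℂ) / 2) *
    (Complex.I ^ m * (Real.sqrt |W.L.det| : ℂ)) with hc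
  have hcn : ‖c‖ = Real.sqrt |LinearMap.det B| := by
    have h1 : (1 / (2 * Real.pi * Complex.I * ħ) : ℂ) ≠ 0 := by
      simp [Real.pi_ne_zero, hħ.ne']
    have h2 : ‖(1 / (2 * Real.pi * Complex.I * ħ) : ℂ)‖ = (2 * Real.pi * ħ)⁻¹ := by
      simp [abs_of_pos Real.pi_pos, abs_of_pos hħ]
    rw [hc, norm_mul, norm_mul, norm_zpow, Complex.norm_I, one_zpow, one_mul, hBdet,
      Complex.norm_cpow_of_ne_zero h1, h2]
    have h3 : ((n : ℂ) / 2).re = n / 2 := by simp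
    have h4 : ((n : ℂ) / 2).im = 0 := by simp
    rw [h3, h4, mul_zero, Real.exp_zero, div_one, abs_mul, Real.sqrt_mul (abs_nonneg _),
      abs_of_pos (by positivity : 0 < ((2 * Real.pi * ħ)⁻¹) ^ n), Complex.norm_real,
      Real.norm_of_nonneg (Real.sqrt_nonneg _), Real.sqrt_eq_rpow (((2 * Real.pi * ħ)⁻¹) ^ n),
      ← Real.rpow_natCast, ← Real.rpow_mul (by positivity)]
    congr 2
    ring
  obtain ⟨U₁, hU₁⟩ := exists_weighted A 0
    (fun x => c * Complex.exp (Complex.I *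
      ((1 / (2 * ħ) * ((W.P *ᵥ x.ofLp) ⬝ᵥ x.ofLp) : ℝ) : ℂ)))
    (continuous_const.mul (hasTemperateGrowth_phase hP).1.continuous) (by
      intro x
      rw [norm_mul, hnorm, mul_one, hcn, hAB])
  refine ⟨(U₂.trans (Lp.fourierTransformₗᵢ (Config n) ℂ)).trans U₁, fun ψ => ?_⟩
  set ψ₁ : 𝓢(Config n, ℂ) := smulLeftCLM ℂ (fun x => Complex.exp (Complex.I *
    ((1 / (2 * ħ) * ((W.Q *ᵥ x.ofLp) ⬝ᵥ x.ofLp) : ℝ) : ℂ))) ψ with hψ₁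
  have e1 : U₂ (ψ.toLp 2) = ψ₁.toLp 2 := by
    apply Lp.ext
    filter_upwards [hU₂ (ψ.toLp 2), ψ.coeFn_toLp 2 volume, ψ₁.coeFn_toLp 2 volume] with x h1 h2 h3
    rw [h1, h3, hψ₁, smulLeftCLM_apply_apply (hasTemperateGrowth_phase hQ)]
    simp only [ContinuousLinearEquiv.refl_apply, add_zero, h2, smul_eq_mul]
  have e2 : Lp.fourierTransformₗᵢ (Config n) ℂ (ψ₁.toLp 2) =
      (FourierTransform.fourier ψ₁ : 𝓢(Config n, ℂ)).toLp 2 := ψ₁.toLp_fourier_eq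
  have e3 : ((U₂.trans (Lp.fourierTransformₗᵢ (Config n) ℂ)).trans U₁) (ψ.toLp 2) =
      U₁ ((FourierTransform.fourier ψ₁ : 𝓢(Config n, ℂ)).toLp 2) := by
    rw [LinearIsometryEquiv.trans_apply, LinearIsometryEquiv.trans_apply, e1, e2]
  rw [e3]
  filter_upwards [hU₁ ((FourierTransform.fourier ψ₁ : 𝓢(Config n, ℂ)).toLp 2),
    (quasi_affine A 0).ae_eq_comp
      ((FourierTransform.fourier ψ₁ : 𝓢(Config n, ℂ)).coeFn_toLp 2 volume)] with x h1 h2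
  simp only [Function.comp] at h2
  rw [h1, h2, quadraticFourierIntegral, ← hc, SchwartzMap.fourier_coe, Real.fourier_eq', mul_assoc,
    ← integral_const_mul]
  congr 1
  refine integral_congr_ae (Filter.Eventually.of_forall fun y => ?_)
  simp only [hψ₁, smulLeftCLM_apply_apply (hasTemperateGrowth_phase hQ), smul_eq_mul, add_zero]
  rw [← mul_assoc, ← mul_assoc, ← Complex.exp_add, ← Complex.exp_add]
  congr 2
  have h5 : inner ℝ y (A x) = (2 * Real.pi * ħ)⁻¹ * ((W.L *ᵥ x.ofLp) ⬝ᵥ y.ofLp) := by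
    rw [hA]
    simp [B, inner_smul_right, EuclideanSpace.inner_eq_star_dotProduct]
  rw [h5, GeneratingForm.eval]
  have hħc : (ħ : ℂ) ≠ 0 := by exact_mod_cast hħ.ne'
  have hπ : (Real.pi : ℂ) ≠ 0 := by exact_mod_cast Real.pi_ne_zero
  push_cast
  field_simp
  ring

/-! ### The groups -/

/-- The metaplectic group `Mp(n)`: the group of unitary operators on `L²(ℝⁿ)` generated by the
quadratic Fourier transforms. -/
def metaplecticGroup (n : ℕ) (ħ : ℝ) : Subgroup (L2 n ≃ₗᵢ[ℂ] L2 n) :=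
  Subgroup.closure {U | ∃ (W : GeneratingForm n) (m : ℤ),
    W.IsMaslovIndex m ∧ IsQuadraticFourierTransform ħ W m U}

/-- The inhomogeneous metaplectic group `IMp(n)`: the group of unitary operators on `L²(ℝⁿ)`
generated by the metaplectic operators and the Heisenberg–Weyl operators. -/
def inhomogeneousMetaplecticGroup (n : ℕ) (ħ : ℝ) : Subgroup (L2 n ≃ₗᵢ[ℂ] L2 n) :=
  Subgroup.closure ((metaplecticGroup n ħ : Set (L2 n ≃ₗᵢ[ℂ] L2 n)) ∪
    {U | ∃ z₀ : Config n × Config n, IsHeisenbergWeyl ħ z₀ U})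

end Feichtinger

end

/-! The proof has two independent halves. Both rest on the functions `Φ_z = wignerTest ħ φ z`, the
phase space translates of the window `φ`, for which `W(ψ, φ)(z)` is a constant times `ψ(Φ_z)`.

*Square integrability.* The reproducing formula
`∫ ⟪Φ_z, g⟫ ψ(Φ_z) dz = (πħ/2)ⁿ ‖φ‖² ψ(g)` (`isReproduced`) gives, since `|⟪Φ_z, g⟫| ≤ ‖φ‖ ‖g‖` in
`L²`, the bound `|ψ(g)| ≤ C ‖g‖ ∫ |ψ(Φ_z)| dz`; so if `W(ψ, φ)` is integrable, `ψ` is represented by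
a square-integrable function. If `ψ` is itself square-integrable, the formula is Moyal's identity:
Parseval in the momentum followed by Fubini (`isReproduced_inner`). To pass to a general `ψ` without
integrating functions with values in the Schwartz space, the formula is stated for two arbitrary
windows. It is then stable under `T ↦ T ∘ A` for `A` in the Weyl algebra
(`IsReproduced.comp_weyl`), because multiplications and derivatives of `Φ_z` are combinations of
`Φ_z` and of the translates of another window, with coefficients linear in `z` that are absorbed by
`⟪Φ_z, g⟫`. The structure theorem `exists_eq_sum_inner` writes every tempered distribution as a
finite sum of functionals `g ↦ ⟪h, A g⟫` with `h ∈ L²` and `A` in the Weyl algebra; it follows from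
a Sobolev inequality, which bounds the Schwartz seminorms by `L²` norms of `A g`, and from the
Hahn–Banach theorem.

*Invariance.* For `f ∈ L²`, `W(f, φ)(z)` is a constant times `⟪R_z φ, f⟫`, where `R_z` is the
reflection about `z` (`phaseReflection`). The unitary operators which preserve the Schwartz space
and satisfy `U R_z U⁻¹ = R_{S z}` with an affine bijection `S` of phase space form a group, and for
them `W(U f, φ)(S z) = W(f, U⁻¹ φ)(z)`. As the Feichtinger algebra is defined with all windows at
once, they preserve it. This group contains chirps, dilations, translations and the Fourier
transform, hence the generators of the inhomogeneous metaplectic group. -/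

noncomputable section

namespace Feichtinger

open scoped LineDeriv FourierTransform

variable {n : ℕ}

/-! ### The Weyl algebra and the structure of tempered distributions -/

/-- Multiplication of a Schwartz function by the linear form `u ↦ ⟨v, u⟩`. -/
def mulInner (v : Config n) : 𝓢(Config n, ℂ) →L[ℂ] 𝓢(Config n, ℂ) :=
  smulLeftCLM ℂ (fun u => ((inner ℝ v u : ℝ) : ℂ))

lemma mulInner_apply (v : Config n) (f : 𝓢(Config n, ℂ)) (u : Config n) :
    mulInner v f u = ((inner ℝ v u : ℝ) : ℂ) * f u := by
  have h : Function.HasTemperateGrowth (fun u : Config n => ((inner ℝ v u : ℝ) : ℂ)) := by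
    fun_prop
  rw [mulInner, smulLeftCLM_apply_apply h, smul_eq_mul]

/-- The derivative of a Schwartz function in the direction `v`. -/
def dirDeriv (v : Config n) : 𝓢(Config n, ℂ) →L[ℂ] 𝓢(Config n, ℂ) :=
  LineDeriv.lineDerivOpCLM ℂ 𝓢(Config n, ℂ) v

lemma dirDeriv_eq (v : Config n) (f : 𝓢(Config n, ℂ)) : dirDeriv v f = ∂_{v} f := rfl

/-- The Weyl algebra: the operators on Schwartz functions generated by the multiplications by
linear forms and the directional derivatives. -/
def weylAlgebra (n : ℕ) : Subalgebra ℂ (𝓢(Config n, ℂ) →L[ℂ] 𝓢(Config n, ℂ)) :=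
  Algebra.adjoin ℂ (Set.range mulInner ∪ Set.range dirDeriv)

lemma mulInner_mem (v : Config n) : mulInner v ∈ weylAlgebra n :=
  Algebra.subset_adjoin (Or.inl ⟨v, rfl⟩)

lemma dirDeriv_mem (v : Config n) : dirDeriv v ∈ weylAlgebra n :=
  Algebra.subset_adjoin (Or.inr ⟨v, rfl⟩)

/-- The Fourier multiplier `1 - Δ/(4π²)`, with symbol `1 + ‖ξ‖²`, is in the Weyl algebra. -/
lemma exists_mem_fourier_apply_eq (n : ℕ) : ∃ A ∈ weylAlgebra n,
    ∀ (f : 𝓢(Config n, ℂ)) (ξ : Config n), 𝓕 (A f) ξ = ((1 + ‖ξ‖ ^ 2 : ℝ) : ℂ) * 𝓕 f ξ := by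
  let b := EuclideanSpace.basisFun (Fin n) ℝ
  refine ⟨1 - ((1 / (4 * Real.pi ^ 2) : ℝ) : ℂ) • ∑ i, dirDeriv (b i) * dirDeriv (b i),
    sub_mem (one_mem _) (Subalgebra.smul_mem _ (sum_mem fun i _ =>
      mul_mem (dirDeriv_mem _) (dirDeriv_mem _)) _), fun f ξ => ?_⟩
  have h1 : ∀ (v : Config n) (g : 𝓢(Config n, ℂ)), 𝓕 (∂_{v} g) ξ =
      2 * Real.pi * Complex.I * ((inner ℝ ξ v : ℝ) : ℂ) * 𝓕 g ξ := fun v g => by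
    rw [fourier_lineDerivOp_eq, smul_apply, smulLeftCLM_apply_apply (by fun_prop)]
    simp [mul_assoc]
  have h2 : 𝓕 ((1 - ((1 / (4 * Real.pi ^ 2) : ℝ) : ℂ) • ∑ i, dirDeriv (b i) * dirDeriv (b i)) f) ξ =
      𝓕 f ξ - ((1 / (4 * Real.pi ^ 2) : ℝ) : ℂ) * ∑ i, 𝓕 (∂_{b i} (∂_{b i} f)) ξ := by
    have e : (1 - ((1 / (4 * Real.pi ^ 2) : ℝ) : ℂ) • ∑ i, dirDeriv (b i) * dirDeriv (b i)) f =
      f - ((1 / (4 * Real.pi ^ 2) : ℝ) : ℂ) • ∑ i, ∂_{b i} (∂_{b i} f) := by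
      simp [dirDeriv_eq]
    rw [e, ← FourierTransform.fourierCLM_apply (R := ℂ), map_sub, map_smul, map_sum]
    simp [sum_apply]
  have h3 : ‖ξ‖ ^ 2 = ∑ i, (inner ℝ ξ (b i)) ^ 2 := by
    rw [← b.sum_sq_norm_inner_left ξ]
    simp
  rw [h2, h3]
  simp_rw [h1]
  have hπ : (Real.pi : ℂ) ≠ 0 := by exact_mod_cast Real.pi_ne_zero
  have h4 : ∑ i, (2 * Real.pi * Complex.I * ((inner ℝ ξ (b i) : ℝ) : ℂ) *
      (2 * Real.pi * Complex.I * ((inner ℝ ξ (b i) : ℝ) : ℂ) * 𝓕 f ξ)) =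
      -(4 * Real.pi ^ 2) * ((∑ i, (inner ℝ ξ (b i)) ^ 2 : ℝ) : ℂ) * 𝓕 f ξ := by
    push_cast
    rw [Finset.mul_sum, Finset.sum_mul]
    refine Finset.sum_congr rfl fun i _ => ?_
    linear_combination 4 * (Real.pi : ℂ) ^ 2 * ((inner ℝ ξ (b i) : ℝ) : ℂ) ^ 2 * 𝓕 f ξ *
      Complex.I_sq
  rw [h4]
  push_cast
  field_simp
  ring

lemma exists_mem_fourier_apply_eq_pow (n N : ℕ) : ∃ A ∈ weylAlgebra n,
    ∀ (f : 𝓢(Config n, ℂ)) (ξ : Config n),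
      𝓕 (A f) ξ = ((1 + ‖ξ‖ ^ 2 : ℝ) : ℂ) ^ N * 𝓕 f ξ := by
  obtain ⟨B, hB, hBf⟩ := exists_mem_fourier_apply_eq n
  induction N with
  | zero => exact ⟨1, one_mem _, fun f ξ => by simp⟩
  | succ N ih =>
    obtain ⟨A, hA, hAf⟩ := ih
    refine ⟨B * A, mul_mem hB hA, fun f ξ => ?_⟩
    rw [mul_apply_eq_comp, hBf, hAf]
    ring

lemma continuous_besselWeight (n : ℕ) :
    Continuous fun ξ : Config n => (((1 + ‖ξ‖ ^ 2 : ℝ) : ℂ) ^ (n + 1))⁻¹ := by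
  refine Continuous.inv₀ (by fun_prop) fun ξ => pow_ne_zero _ ?_
  exact_mod_cast (by positivity : 0 < 1 + ‖ξ‖ ^ 2).ne'

lemma memLp_besselWeight (n : ℕ) :
    MemLp (fun ξ : Config n => (((1 + ‖ξ‖ ^ 2 : ℝ) : ℂ) ^ (n + 1))⁻¹) 2 volume := by
  have hpos : ∀ ξ : Config n, 0 < 1 + ‖ξ‖ ^ 2 := fun ξ => by positivity
  rw [memLp_two_iff_integrable_sq_norm (continuous_besselWeight n).aestronglyMeasurable]
  have h := integrable_rpow_neg_one_add_norm_sq (E := Config n) (μ := volume)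
    (r := 4 * (n + 1 : ℕ)) (by
      rw [finrank_euclideanSpace_fin]; exact_mod_cast (by omega : n < 4 * (n + 1)))
  refine h.congr (Filter.Eventually.of_forall fun ξ => ?_)
  have e : -(4 * ((n + 1 : ℕ) : ℝ)) / 2 = -((((n + 1) * 2 : ℕ)) : ℝ) := by push_cast; ring
  beta_reduce
  rw [e, Real.rpow_neg (hpos ξ).le, Real.rpow_natCast, norm_inv, norm_pow, Complex.norm_real,
    Real.norm_of_nonneg (hpos ξ).le, inv_pow, pow_mul]

lemma norm_apply_le_integral_fourier (f : 𝓢(Config n, ℂ)) (u : Config n) :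
    ‖f u‖ ≤ ∫ ξ, ‖𝓕 f ξ‖ := by
  have e : f u = 𝓕⁻ (𝓕 f : 𝓢(Config n, ℂ)) u := by rw [FourierTransform.fourierInv_fourier_eq]
  rw [e, fourierInv_coe, Real.fourierInv_eq']
  refine (norm_integral_le_integral_norm _).trans (le_of_eq ?_)
  congr 1
  funext ξ
  rw [norm_smul, Complex.norm_exp_ofReal_mul_I, one_mul]

lemma integral_norm_mul_le {α : Type*} [MeasurableSpace α] {μ : Measure α} {w F : α → ℂ}
    (hw : MemLp w 2 μ) (hF : MemLp F 2 μ) :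
    ∫ ξ, ‖w ξ * F ξ‖ ∂μ ≤ (eLpNorm w 2 μ).toReal * (eLpNorm F 2 μ).toReal := by
  have h2 : eLpNorm (w • F) 1 μ ≤ eLpNorm w 2 μ * eLpNorm F 2 μ :=
    eLpNorm_smul_le_mul_eLpNorm hF.1 hw.1
  have h3 := ENNReal.toReal_mono (ENNReal.mul_ne_top hw.2.ne hF.2.ne) h2
  rw [ENNReal.toReal_mul, eLpNorm_one_eq_lintegral_enorm] at h3
  have h4 : ∫ ξ, ‖(w • F) ξ‖ ∂μ = _ := integral_norm_eq_lintegral_enorm (hw.1.smul hF.1)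
  exact h4.trans_le h3

/-- A Sobolev inequality: `‖f‖_∞ ≤ ‖𝓕 f‖₁`, and Hölder's inequality applied to
`𝓕 f = (1 + ‖ξ‖²)⁻ᴺ · (1 + ‖ξ‖²)ᴺ 𝓕 f` with `N = n + 1`, whose first factor is in `L²`. -/
lemma exists_norm_apply_le (n : ℕ) : ∃ A ∈ weylAlgebra n, ∃ C : ℝ, 0 ≤ C ∧
    ∀ (f : 𝓢(Config n, ℂ)) (u : Config n), ‖f u‖ ≤ C * ‖(A f).toLp 2‖ := by
  obtain ⟨A, hA, hAf⟩ := exists_mem_fourier_apply_eq_pow n (n + 1)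
  refine ⟨A, hA, (eLpNorm (fun ξ : Config n => (((1 + ‖ξ‖ ^ 2 : ℝ) : ℂ) ^ (n + 1))⁻¹) 2
    volume).toReal, ENNReal.toReal_nonneg, fun f u => ?_⟩
  have h := integral_norm_mul_le (memLp_besselWeight n) ((𝓕 (A f)).memLp 2)
  rw [← norm_toLp, norm_fourier_toL2_eq] at h
  refine (norm_apply_le_integral_fourier f u).trans (le_trans (le_of_eq ?_) h)
  congr 1
  funext ξ
  rw [hAf, inv_mul_cancel_left₀]
  exact pow_ne_zero _ (by exact_mod_cast (by positivity : 0 < 1 + ‖ξ‖ ^ 2).ne')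

/-- A real function on the Schwartz space is dominated by the Weyl algebra if it is bounded by a
multiple of a finite sum of seminorms `f ↦ ‖A f‖₂` with `A` in the Weyl algebra. -/
def WeylDominated (q : 𝓢(Config n, ℂ) → ℝ) : Prop :=
  ∃ s : List (𝓢(Config n, ℂ) →L[ℂ] 𝓢(Config n, ℂ)), (∀ A ∈ s, A ∈ weylAlgebra n) ∧
    ∃ C : ℝ, 0 ≤ C ∧ ∀ f, q f ≤ C * (s.map fun A => ‖(A f).toLp 2‖).sum

lemma sum_norm_nonneg (s : List (𝓢(Config n, ℂ) →L[ℂ] 𝓢(Config n, ℂ))) (f : 𝓢(Config n, ℂ)) :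
    0 ≤ (s.map fun A => ‖(A f).toLp 2‖).sum := by
  refine List.sum_nonneg fun x hx => ?_
  obtain ⟨A, -, rfl⟩ := List.mem_map.1 hx
  exact norm_nonneg _

lemma WeylDominated.of_le {q q' : 𝓢(Config n, ℂ) → ℝ} (h : WeylDominated q') {K : ℝ} (hK : 0 ≤ K)
    (hq : ∀ f, q f ≤ K * q' f) : WeylDominated q := by
  obtain ⟨s, hs, C, hC, hf⟩ := h
  refine ⟨s, hs, K * C, by positivity, fun f => (hq f).trans ?_⟩
  rw [mul_assoc]
  exact mul_le_mul_of_nonneg_left (hf f) hK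

lemma WeylDominated.add {q q' : 𝓢(Config n, ℂ) → ℝ} (h : WeylDominated q)
    (h' : WeylDominated q') : WeylDominated (fun f => q f + q' f) := by
  obtain ⟨s, hs, C, hC, hf⟩ := h
  obtain ⟨s', hs', C', hC', hf'⟩ := h'
  refine ⟨s ++ s', fun A hA => (List.mem_append.1 hA).elim (hs A) (hs' A), C + C', by positivity,
    fun f => ?_⟩
  have h1 := mul_nonneg hC (sum_norm_nonneg s' f)
  have h2 := mul_nonneg hC' (sum_norm_nonneg s f)
  rw [List.map_append, List.sum_append]
  linarith [hf f, hf' f]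

lemma WeylDominated.sum {ι : Type*} (t : Finset ι) {q : ι → 𝓢(Config n, ℂ) → ℝ}
    (h : ∀ i, WeylDominated (q i)) : WeylDominated (fun f => ∑ i ∈ t, q i f) := by
  classical
  induction t using Finset.induction_on with
  | empty => exact ⟨[], by simp, 0, le_rfl, by simp⟩
  | insert i t hi ih => simpa only [Finset.sum_insert hi] using (h i).add ih

lemma WeylDominated.comp {q : 𝓢(Config n, ℂ) → ℝ} (h : WeylDominated q)
    {B : 𝓢(Config n, ℂ) →L[ℂ] 𝓢(Config n, ℂ)} (hB : B ∈ weylAlgebra n) :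
    WeylDominated (fun f => q (B f)) := by
  obtain ⟨s, hs, C, hC, hf⟩ := h
  refine ⟨s.map (· * B), fun A hA => ?_, C, hC, fun f => (hf (B f)).trans (le_of_eq ?_)⟩
  · obtain ⟨A', hA', rfl⟩ := List.mem_map.1 hA
    exact mul_mem (hs A' hA') hB
  · rw [List.map_map]
    rfl

lemma norm_le_sum_inner_basis (x : Config n) :
    ‖x‖ ≤ ∑ i, |inner ℝ (EuclideanSpace.basisFun (Fin n) ℝ i) x| := by
  conv_lhs => rw [← (EuclideanSpace.basisFun (Fin n) ℝ).sum_repr' x]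
  refine (norm_sum_le _ _).trans (Finset.sum_le_sum fun i _ => ?_)
  rw [norm_smul, (EuclideanSpace.basisFun (Fin n) ℝ).norm_eq_one, mul_one, Real.norm_eq_abs]

/-- A derivative of order `l + 1` is controlled by the derivatives of order `l` of the partial
derivatives. -/
lemma norm_iteratedFDeriv_succ_le (f : 𝓢(Config n, ℂ)) (l : ℕ) (x : Config n) :
    ‖iteratedFDeriv ℝ (l + 1) f x‖ ≤
      ∑ i, ‖iteratedFDeriv ℝ l (dirDeriv (EuclideanSpace.basisFun (Fin n) ℝ i) f) x‖ := by
  let b := EuclideanSpace.basisFun (Fin n) ℝ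
  -- The total derivative is recovered from the partial derivatives by the maps `T i`, which are
  -- contractions.
  let T : Fin n → ℂ →L[ℝ] (Config n →L[ℝ] ℂ) := fun i =>
    ContinuousLinearMap.smulRightL ℝ (Config n) ℂ (innerSL ℝ (b i))
  have hT : ∀ i, ‖T i‖ ≤ 1 := fun i => by
    refine ContinuousLinearMap.opNorm_le_bound _ zero_le_one fun c => ?_
    simp [T, ContinuousLinearMap.norm_smulRight_apply, b]
  have h1 : fderiv ℝ f = fun y => ∑ i, (T i ∘ dirDeriv (b i) f) y := by
    funext y
    ext v
    have hv : fderiv ℝ f y v = fderiv ℝ f y (∑ i, inner ℝ (b i) v • b i) := by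
      rw [b.sum_repr' v]
    rw [hv, map_sum, sum_apply]
    refine Finset.sum_congr rfl fun i _ => ?_
    rw [map_smul, ← lineDerivOp_apply_eq_fderiv]
    rfl
  have hs : ∀ i, ContDiff ℝ l (dirDeriv (b i) f) := fun i => (dirDeriv (b i) f).smooth l
  rw [← norm_iteratedFDeriv_fderiv, h1, iteratedFDeriv_fun_sum_apply fun i _ =>
    ((T i).contDiff.comp (hs i)).contDiffAt]
  refine (norm_sum_le _ _).trans (Finset.sum_le_sum fun i _ => ?_)
  refine ((T i).norm_iteratedFDeriv_comp_left (hs i).contDiffAt le_rfl).trans ?_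
  exact mul_le_of_le_one_left (norm_nonneg _) (hT i)

/-- Induction on the order of the derivative and then on the weight reduces every Schwartz seminorm
to the supremum norm, where the Sobolev inequality applies. -/
lemma weylDominated_seminorm (k l : ℕ) :
    WeylDominated (fun f : 𝓢(Config n, ℂ) => SchwartzMap.seminorm ℂ k l f) := by
  let b := EuclideanSpace.basisFun (Fin n) ℝ
  induction l with
  | zero =>
    induction k with
    | zero =>
      obtain ⟨A, hA, C, hC, h⟩ := exists_norm_apply_le n
      refine ⟨[A], by simpa using hA, C, hC, fun f => ?_⟩
      refine seminorm_le_bound ℂ 0 0 f (mul_nonneg hC (sum_norm_nonneg _ f)) fun x => ?_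
      simpa using h f x
    | succ k ih =>
      refine (WeylDominated.sum Finset.univ fun i => ih.comp (mulInner_mem (b i))).of_le
        zero_le_one fun f => ?_
      rw [one_mul]
      refine seminorm_le_bound ℂ _ _ f (Finset.sum_nonneg fun i _ => apply_nonneg _ _) fun x => ?_
      rw [norm_iteratedFDeriv_zero, pow_succ, mul_assoc]
      refine (mul_le_mul_of_nonneg_left (mul_le_mul_of_nonneg_right (norm_le_sum_inner_basis x)
        (norm_nonneg _)) (by positivity)).trans ?_
      rw [Finset.sum_mul, Finset.mul_sum]
      refine Finset.sum_le_sum fun i _ => ?_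
      have h := norm_pow_mul_le_seminorm ℂ (mulInner (b i) f) k x
      rwa [mulInner_apply, norm_mul, Complex.norm_real, Real.norm_eq_abs] at h
  | succ l ih =>
    refine (WeylDominated.sum Finset.univ fun i => ih.comp (dirDeriv_mem (b i))).of_le
      zero_le_one fun f => ?_
    rw [one_mul]
    refine seminorm_le_bound ℂ _ _ f (Finset.sum_nonneg fun i _ => apply_nonneg _ _) fun x => ?_
    refine (mul_le_mul_of_nonneg_left (norm_iteratedFDeriv_succ_le f l x) (by positivity)).trans ?_
    rw [Finset.mul_sum]
    exact Finset.sum_le_sum fun i _ => le_seminorm ℂ k l _ x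

/-- A linear functional bounded by the norm of a linear map into a Hilbert space factors through
that map: Hahn–Banach on its range, and the Riesz representation. -/
lemma exists_inner_eq_of_norm_le {E H : Type*} [AddCommGroup E] [Module ℂ E]
    [NormedAddCommGroup H] [InnerProductSpace ℂ H] [CompleteSpace H] (T : E →ₗ[ℂ] ℂ)
    (S : E →ₗ[ℂ] H) (C : ℝ) (h : ∀ g, ‖T g‖ ≤ C * ‖S g‖) : ∃ y : H, ∀ g, T g = inner ℂ y (S g) := by
  have hker : LinearMap.ker S ≤ LinearMap.ker T := fun g hg => by
    have h1 := h g
    rw [LinearMap.mem_ker.1 hg, norm_zero, mul_zero] at h1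
    exact norm_le_zero_iff.1 h1
  let Ψ₀ : LinearMap.range S →ₗ[ℂ] ℂ :=
    ((LinearMap.ker S).liftQ T hker).comp S.quotKerEquivRange.symm.toLinearMap
  have hΨ₀ : ∀ g, Ψ₀ ⟨S g, g, rfl⟩ = T g := fun g => by
    have e : S.quotKerEquivRange.symm ⟨S g, g, rfl⟩ = (LinearMap.ker S).mkQ g :=
      S.quotKerEquivRange_symm_apply_image g _
    simp only [Ψ₀, LinearMap.comp_apply, LinearEquiv.coe_coe]
    rw [e]
    rfl
  let Ψ₁ : LinearMap.range S →L[ℂ] ℂ := Ψ₀.mkContinuous C (by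
    rintro ⟨_, g, rfl⟩
    rw [hΨ₀]
    exact h g)
  obtain ⟨Ψ, hΨ, -⟩ := exists_extension_norm_eq (LinearMap.range S) Ψ₁
  refine ⟨(InnerProductSpace.toDual ℂ H).symm Ψ, fun g => ?_⟩
  rw [InnerProductSpace.toDual_symm_apply, ← hΨ₀ g]
  exact (hΨ ⟨S g, g, rfl⟩).symm

lemma weylDominated_norm (ψ : 𝓢'(Config n, ℂ)) : WeylDominated (fun f => ‖ψ f‖) := by
  have hc : Continuous fun f => ψ f := ψ.continuous
  obtain ⟨s, C, -, hC⟩ := Seminorm.bound_of_continuous (schwartz_withSeminorms ℂ (Config n) ℂ)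
    ((normSeminorm ℂ ℂ).comp ψ.toLinearMap) (continuous_norm.comp hc)
  refine (WeylDominated.sum s fun i => weylDominated_seminorm i.1 i.2).of_le C.2 fun f => ?_
  refine (hC f).trans ?_
  have h := Seminorm.finset_sup_le_sum (schwartzSeminormFamily ℂ (Config n) ℂ) s f
  rw [smul_apply, NNReal.smul_def, smul_eq_mul]
  refine mul_le_mul_of_nonneg_left (h.trans (le_of_eq ?_)) C.2
  rw [sum_apply]
  rfl

/-- The structure of tempered distributions: each is a finite sum of functionals
`g ↦ ⟪h, A g⟫` with `h ∈ L²` and `A` in the Weyl algebra. -/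
theorem exists_eq_sum_inner (ψ : 𝓢'(Config n, ℂ)) :
    ∃ (m : ℕ) (A : Fin m → 𝓢(Config n, ℂ) →L[ℂ] 𝓢(Config n, ℂ)) (h : Fin m → L2 n),
      (∀ i, A i ∈ weylAlgebra n) ∧ ∀ g, ψ g = ∑ i, inner ℂ (h i) ((A i g).toLp 2) := by
  obtain ⟨s, hs, C, hC, hf⟩ := weylDominated_norm ψ
  let S : 𝓢(Config n, ℂ) →ₗ[ℂ] PiLp 2 (fun _ : Fin s.length => L2 n) :=
    (WithLp.linearEquiv 2 ℂ _).symm.toLinearMap.comp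
      (LinearMap.pi fun i => ((toLpCLM ℂ ℂ 2 volume).comp (s.get i)).toLinearMap)
  have hS : ∀ g i, S g i = (s.get i g).toLp 2 := fun g i => rfl
  obtain ⟨y, hy⟩ := exists_inner_eq_of_norm_le ψ.toLinearMap S (C * s.length) fun g => by
    refine (hf g).trans ?_
    rw [mul_assoc]
    refine mul_le_mul_of_nonneg_left ?_ hC
    rw [← Fin.sum_univ_fun_getElem]
    refine (Finset.sum_le_card_nsmul _ _ ‖S g‖ fun i _ => ?_).trans (le_of_eq (by simp))
    exact PiLp.norm_apply_le (S g) i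
  refine ⟨s.length, s.get, y.ofLp, fun i => hs _ (List.get_mem _ _), fun g => ?_⟩
  exact (hy g).trans (PiLp.inner_apply _ _)

/-! ### Phase space translates of a window -/

/-- Multiplication by a linear form acts on the translates of a window as a position coordinate of
phase space, up to a change of window. -/
lemma mulInner_wignerTest (ħ : ℝ) (φ : 𝓢(Config n, ℂ)) (z : Config n × Config n) (v : Config n) :
    mulInner v (wignerTest ħ φ z) =
      (2 * ((inner ℝ v z.1 : ℝ) : ℂ)) • wignerTest ħ φ z - wignerTest ħ (mulInner v φ) z := by
  ext u
  simp only [mulInner_apply, sub_apply, smul_apply, wignerTest_apply, smul_eq_mul, map_mul,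
    Complex.conj_ofReal, inner_sub_right, inner_smul_right]
  push_cast
  ring

/-- A derivative acts on the translates of a window as a momentum coordinate of phase space, up to a
change of window. -/
lemma dirDeriv_wignerTest (ħ : ℝ) (φ : 𝓢(Config n, ℂ)) (z : Config n × Config n) (v : Config n) :
    dirDeriv v (wignerTest ħ φ z) =
      (-(2 * Complex.I / ħ * ((inner ℝ z.2 v : ℝ) : ℂ))) • wignerTest ħ φ z
        - wignerTest ħ (dirDeriv v φ) z := by
  ext u
  rw [dirDeriv_eq, lineDerivOp_apply, lineDeriv]
  simp only [sub_apply, smul_apply, wignerTest_apply, smul_eq_mul]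
  have h0 : HasDerivAt (fun t : ℝ => (2 : ℝ) • z.1 - (u + t • v)) (-v) 0 := by
    have h := (((hasDerivAt_id (0 : ℝ)).smul_const v).const_add u).const_sub ((2 : ℝ) • z.1)
    simpa using h
  have h1 : HasDerivAt (fun t : ℝ => conj (φ ((2 : ℝ) • z.1 - (u + t • v))))
      (-conj (dirDeriv v φ ((2 : ℝ) • z.1 - u))) 0 := by
    have hφ := φ.hasFDerivAt ((2 : ℝ) • z.1 - (u + (0 : ℝ) • v))
    have h := (Complex.conjCLE.toContinuousLinearMap.hasFDerivAt).comp_hasDerivAt (0 : ℝ)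
      (hφ.comp_hasDerivAt (0 : ℝ) h0)
    have e : -conj (dirDeriv v φ ((2 : ℝ) • z.1 - u)) = Complex.conjCLE.toContinuousLinearMap
        (fderiv ℝ φ ((2 : ℝ) • z.1 - (u + (0 : ℝ) • v)) (-v)) := by
      rw [map_neg, map_neg, zero_smul, add_zero, dirDeriv_eq, lineDerivOp_apply_eq_fderiv]
      rfl
    rw [e]
    exact h
  have h2 : HasDerivAt (fun t : ℝ => -(2 / ħ) * inner ℝ z.2 (u + t • v - z.1))
      (-(2 / ħ) * inner ℝ z.2 v) 0 := by
    have h : (fun t : ℝ => -(2 / ħ) * inner ℝ z.2 (u + t • v - z.1)) =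
        fun t : ℝ => -(2 / ħ) * inner ℝ z.2 (u - z.1) + t * (-(2 / ħ) * inner ℝ z.2 v) := by
      funext t
      rw [add_sub_right_comm, inner_add_right, inner_smul_right]
      ring
    rw [h]
    simpa using ((hasDerivAt_id (0 : ℝ)).mul_const (-(2 / ħ) * inner ℝ z.2 v)).const_add
      (-(2 / ħ) * inner ℝ z.2 (u - z.1))
  have h3 := (((h2.ofReal_comp).const_mul Complex.I).cexp).mul h1
  have h4 := h3.deriv
  refine h4.trans ?_
  simp only [zero_smul, add_zero]
  push_cast
  ring

lemma continuous_wignerTest (ħ : ℝ) (φ : 𝓢(Config n, ℂ)) :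
    Continuous fun q : (Config n × Config n) × Config n => wignerTest ħ φ q.1 q.2 := by
  simp only [wignerTest_apply]
  have := φ.continuous
  fun_prop

lemma norm_wignerTest (ħ : ℝ) (φ : 𝓢(Config n, ℂ)) (z : Config n × Config n) (u : Config n) :
    ‖wignerTest ħ φ z u‖ = ‖φ ((2 : ℝ) • z.1 - u)‖ := by
  rw [wignerTest_apply, norm_mul, mul_comm Complex.I, Complex.norm_exp_ofReal_mul_I, one_mul,
    RCLike.norm_conj]

lemma norm_toLp_wignerTest (ħ : ℝ) (φ : 𝓢(Config n, ℂ)) (z : Config n × Config n) :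
    ‖(wignerTest ħ φ z).toLp 2‖ = ‖φ.toLp 2‖ := by
  rw [norm_toLp, norm_toLp]
  congr 1
  rw [← eLpNorm_comp_measurePreserving φ.continuous.aestronglyMeasurable
    (Measure.measurePreserving_sub_left volume ((2 : ℝ) • z.1))]
  exact eLpNorm_congr_norm_ae (Filter.Eventually.of_forall fun u => norm_wignerTest ħ φ z u)

lemma inner_mulInner (v : Config n) (a b : 𝓢(Config n, ℂ)) :
    inner ℂ ((mulInner v a).toLp 2) (b.toLp 2) = inner ℂ (a.toLp 2) ((mulInner v b).toLp 2) := by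
  rw [inner_toL2_toL2_eq _ _ volume, inner_toL2_toL2_eq _ _ volume]
  congr 1
  funext u
  simp only [mulInner_apply, RCLike.inner_apply, map_mul, Complex.conj_ofReal]
  ring

lemma inner_dirDeriv (v : Config n) (a b : 𝓢(Config n, ℂ)) :
    inner ℂ ((dirDeriv v a).toLp 2) (b.toLp 2) = -inner ℂ (a.toLp 2) ((dirDeriv v b).toLp 2) := by
  rw [inner_toL2_toL2_eq _ _ volume, inner_toL2_toL2_eq _ _ volume, eq_neg_iff_add_eq_zero,
    add_comm, ← eq_neg_iff_add_eq_zero]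
  exact integral_bilinear_lineDerivOp_right_eq_neg_left a b
    ((ContinuousLinearMap.mul ℝ ℂ).flip.comp (Complex.conjCLE : ℂ →L[ℝ] ℂ)) v

/-- The coefficient `⟪Φ_z, g⟫` of `g` against the phase space translate `Φ_z = wignerTest ħ φ z`
of the window `φ`. -/
def windowCoeff (ħ : ℝ) (φ g : 𝓢(Config n, ℂ)) (z : Config n × Config n) : ℂ :=
  inner ℂ ((wignerTest ħ φ z).toLp 2) (g.toLp 2)

lemma toLp_two_sub (a b : 𝓢(Config n, ℂ)) :
    (a - b).toLp 2 volume = a.toLp 2 volume - b.toLp 2 volume :=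
  map_sub (toLpCLM ℂ ℂ 2 volume) a b

lemma toLp_two_smul (c : ℂ) (a : 𝓢(Config n, ℂ)) : (c • a).toLp 2 volume = c • a.toLp 2 volume :=
  map_smul (toLpCLM ℂ ℂ 2 volume) c a

lemma position_mul_windowCoeff (ħ : ℝ) (φ g : 𝓢(Config n, ℂ)) (z : Config n × Config n)
    (v : Config n) : 2 * ((inner ℝ v z.1 : ℝ) : ℂ) * windowCoeff ħ φ g z =
      windowCoeff ħ φ (mulInner v g) z + windowCoeff ħ (mulInner v φ) g z := by
  simp only [windowCoeff]
  rw [← inner_mulInner, mulInner_wignerTest, toLp_two_sub, toLp_two_smul, inner_sub_left,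
    inner_smul_left, map_mul, map_ofNat, Complex.conj_ofReal]
  ring

lemma momentum_mul_windowCoeff (ħ : ℝ) (φ g : 𝓢(Config n, ℂ)) (z : Config n × Config n)
    (v : Config n) : 2 * Complex.I / ħ * ((inner ℝ z.2 v : ℝ) : ℂ) * windowCoeff ħ φ g z =
      windowCoeff ħ (dirDeriv v φ) g z - windowCoeff ħ φ (dirDeriv v g) z := by
  have h := inner_dirDeriv v (wignerTest ħ φ z) g
  rw [dirDeriv_wignerTest, toLp_two_sub, toLp_two_smul, inner_sub_left, inner_smul_left] at h
  simp only [windowCoeff]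
  simp only [map_neg, map_mul, map_div₀, Complex.conj_I, Complex.conj_ofReal, map_ofNat] at h
  linear_combination h

lemma norm_windowCoeff_le (ħ : ℝ) (φ g : 𝓢(Config n, ℂ)) (z : Config n × Config n) :
    ‖windowCoeff ħ φ g z‖ ≤ ‖φ.toLp 2‖ * ‖g.toLp 2‖ := by
  rw [← norm_toLp_wignerTest ħ φ z]
  exact norm_inner_le_norm _ _

/-- The coefficients decay rapidly: multiplying them by a coordinate of phase space gives
coefficients of other Schwartz functions against other windows. -/
lemma exists_pow_mul_norm_windowCoeff_le {ħ : ℝ} (hħ : 0 < ħ) (N : ℕ) (φ g : 𝓢(Config n, ℂ)) :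
    ∃ C : ℝ, ∀ z, ‖z‖ ^ N * ‖windowCoeff ħ φ g z‖ ≤ C := by
  induction N generalizing φ g with
  | zero => exact ⟨_, fun z => by simpa using norm_windowCoeff_le ħ φ g z⟩
  | succ N ih =>
    let b := EuclideanSpace.basisFun (Fin n) ℝ
    choose C hC using ih
    refine ⟨∑ i, ((C φ (mulInner (b i) g) + C (mulInner (b i) φ) g) +
      ħ * (C (dirDeriv (b i) φ) g + C φ (dirDeriv (b i) g))), fun z => ?_⟩
    have hz : ‖z‖ ≤ ∑ i, (|inner ℝ (b i) z.1| + |inner ℝ z.2 (b i)|) := by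
      have h1 := norm_le_sum_inner_basis z.1
      have h2 := norm_le_sum_inner_basis z.2
      rw [Finset.sum_add_distrib]
      simp_rw [real_inner_comm (b _) z.2] at *
      have p1 : 0 ≤ ∑ i, |inner ℝ (b i) z.1| := Finset.sum_nonneg fun i _ => abs_nonneg _
      have p2 : 0 ≤ ∑ i, |inner ℝ (b i) z.2| := Finset.sum_nonneg fun i _ => abs_nonneg _
      rw [Prod.norm_def]
      exact max_le (by linarith) (by linarith)
    rw [pow_succ, mul_assoc]
    refine (mul_le_mul_of_nonneg_left (mul_le_mul_of_nonneg_right hz (norm_nonneg _))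
      (by positivity)).trans ?_
    rw [Finset.sum_mul, Finset.mul_sum]
    refine Finset.sum_le_sum fun i _ => ?_
    rw [add_mul, mul_add]
    have hN : 0 ≤ ‖z‖ ^ N := by positivity
    refine add_le_add ?_ ?_
    · have h := congrArg norm (position_mul_windowCoeff ħ φ g z (b i))
      rw [norm_mul, norm_mul, Complex.norm_real, Real.norm_eq_abs, Complex.norm_ofNat] at h
      have h1 := norm_add_le (windowCoeff ħ φ (mulInner (b i) g) z)
        (windowCoeff ħ (mulInner (b i) φ) g z)
      have h2 : |inner ℝ (b i) z.1| * ‖windowCoeff ħ φ g z‖ ≤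
          ‖windowCoeff ħ φ (mulInner (b i) g) z‖ + ‖windowCoeff ħ (mulInner (b i) φ) g z‖ := by
        have : 0 ≤ |inner ℝ (b i) z.1| * ‖windowCoeff ħ φ g z‖ := by positivity
        linarith
      have h3 := mul_le_mul_of_nonneg_left h2 hN
      rw [mul_add] at h3
      linarith [hC φ (mulInner (b i) g) z, hC (mulInner (b i) φ) g z]
    · have h := congrArg norm (momentum_mul_windowCoeff ħ φ g z (b i))
      rw [norm_mul, norm_mul, norm_div, norm_mul, Complex.norm_real, Complex.norm_real,
        Real.norm_eq_abs, Real.norm_eq_abs, Complex.norm_ofNat, Complex.norm_I, abs_of_pos hħ] at h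
      have h1 := norm_sub_le (windowCoeff ħ (dirDeriv (b i) φ) g z)
        (windowCoeff ħ φ (dirDeriv (b i) g) z)
      have h2 : |inner ℝ z.2 (b i)| * ‖windowCoeff ħ φ g z‖ ≤ ħ *
          (‖windowCoeff ħ (dirDeriv (b i) φ) g z‖ + ‖windowCoeff ħ φ (dirDeriv (b i) g) z‖) := by
        have : 0 ≤ |inner ℝ z.2 (b i)| * ‖windowCoeff ħ φ g z‖ := by positivity
        have e : 2 * (|inner ℝ z.2 (b i)| * ‖windowCoeff ħ φ g z‖) =
            ħ * (2 * 1 / ħ * |inner ℝ z.2 (b i)| * ‖windowCoeff ħ φ g z‖) := by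
          field_simp
        rw [h] at e
        have := mul_le_mul_of_nonneg_left h1 hħ.le
        linarith
      have h3 := mul_le_mul_of_nonneg_left h2 hN
      have h4 := mul_le_mul_of_nonneg_left (add_le_add (hC (dirDeriv (b i) φ) g z)
        (hC φ (dirDeriv (b i) g) z)) hħ.le
      linarith

/-! ### The reproducing formula -/

/-- The reproducing formula `∫ ⟪Φ¹_z, g⟫ T(Φ²_z) dz = (πħ/2)ⁿ ⟪φ₂, φ₁⟫ T(g)` holds for the
functional `T`, with absolute convergence, for all windows `φ₁`, `φ₂`, where
`Φʲ_z = wignerTest ħ φⱼ z`. -/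
def IsReproduced (ħ : ℝ) (T : 𝓢(Config n, ℂ) →ₗ[ℂ] ℂ) : Prop :=
  ∀ φ₁ φ₂ g : 𝓢(Config n, ℂ),
    Integrable (fun z => windowCoeff ħ φ₁ g z * T (wignerTest ħ φ₂ z)) ∧
    ∫ z, windowCoeff ħ φ₁ g z * T (wignerTest ħ φ₂ z) =
      ((Real.pi * ħ / 2 : ℝ) : ℂ) ^ n * inner ℂ (φ₂.toLp 2) (φ₁.toLp 2) * T g

lemma IsReproduced.zero (ħ : ℝ) : IsReproduced ħ (0 : 𝓢(Config n, ℂ) →ₗ[ℂ] ℂ) :=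
  fun φ₁ φ₂ g => by simp

lemma IsReproduced.add {ħ : ℝ} {T T' : 𝓢(Config n, ℂ) →ₗ[ℂ] ℂ} (h : IsReproduced ħ T)
    (h' : IsReproduced ħ T') : IsReproduced ħ (T + T') := fun φ₁ φ₂ g => by
  obtain ⟨h1, h2⟩ := h φ₁ φ₂ g
  obtain ⟨h1', h2'⟩ := h' φ₁ φ₂ g
  simp only [LinearMap.add_apply, mul_add]
  exact ⟨h1.add h1', by rw [integral_add h1 h1', h2, h2']⟩

lemma IsReproduced.smul {ħ : ℝ} {T : 𝓢(Config n, ℂ) →ₗ[ℂ] ℂ} (h : IsReproduced ħ T) (c : ℂ) :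
    IsReproduced ħ (c • T) := fun φ₁ φ₂ g => by
  obtain ⟨h1, h2⟩ := h φ₁ φ₂ g
  simp only [LinearMap.smul_apply, smul_eq_mul, mul_left_comm _ c]
  exact ⟨h1.const_mul c, by rw [integral_const_mul, h2]⟩

lemma IsReproduced.sum {ħ : ℝ} {ι : Type*} (s : Finset ι) {T : ι → 𝓢(Config n, ℂ) →ₗ[ℂ] ℂ}
    (h : ∀ i, IsReproduced ħ (T i)) : IsReproduced ħ (∑ i ∈ s, T i) := by
  classical
  induction s using Finset.induction_on with
  | empty => simpa using IsReproduced.zero ħ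
  | insert i s hi ih => rw [Finset.sum_insert hi]; exact (h i).add ih

/-- The factor `2⟨v, x⟩` that multiplication by `⟨v, ·⟩` produces on `Φ_z` is moved to the
coefficient `⟪Φ_z, g⟫`; the two terms with a modified window cancel by symmetry. -/
lemma IsReproduced.comp_mulInner {ħ : ℝ} {T : 𝓢(Config n, ℂ) →ₗ[ℂ] ℂ} (h : IsReproduced ħ T)
    (v : Config n) : IsReproduced ħ (T ∘ₗ (mulInner v).toLinearMap) := fun φ₁ φ₂ g => by
  obtain ⟨h1, e1⟩ := h φ₁ φ₂ (mulInner v g)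
  obtain ⟨h2, e2⟩ := h (mulInner v φ₁) φ₂ g
  obtain ⟨h3, e3⟩ := h φ₁ (mulInner v φ₂) g
  have e : (fun z => windowCoeff ħ φ₁ g z *
      (T ∘ₗ (mulInner v).toLinearMap) (wignerTest ħ φ₂ z)) = fun z =>
      windowCoeff ħ φ₁ (mulInner v g) z * T (wignerTest ħ φ₂ z) +
      windowCoeff ħ (mulInner v φ₁) g z * T (wignerTest ħ φ₂ z) -
      windowCoeff ħ φ₁ g z * T (wignerTest ħ (mulInner v φ₂) z) := by
    funext z
    have hz : (T ∘ₗ (mulInner v).toLinearMap) (wignerTest ħ φ₂ z) =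
        T (mulInner v (wignerTest ħ φ₂ z)) := rfl
    rw [hz, mulInner_wignerTest, map_sub, map_smul, smul_eq_mul]
    linear_combination T (wignerTest ħ φ₂ z) * position_mul_windowCoeff ħ φ₁ g z v
  have h12 := h1.add h2
  rw [e]
  refine ⟨h12.sub h3, ?_⟩
  have hg : (T ∘ₗ (mulInner v).toLinearMap) g = T (mulInner v g) := rfl
  refine (integral_sub h12 h3).trans ?_
  rw [integral_add' h1 h2, e1, e2, e3, inner_mulInner, hg]
  ring

/-- As for multiplications, with the momentum in place of the position and integration by parts in
place of symmetry. -/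
lemma IsReproduced.comp_dirDeriv {ħ : ℝ} {T : 𝓢(Config n, ℂ) →ₗ[ℂ] ℂ} (h : IsReproduced ħ T)
    (v : Config n) : IsReproduced ħ (T ∘ₗ (dirDeriv v).toLinearMap) := fun φ₁ φ₂ g => by
  obtain ⟨h1, e1⟩ := h φ₁ φ₂ (dirDeriv v g)
  obtain ⟨h2, e2⟩ := h (dirDeriv v φ₁) φ₂ g
  obtain ⟨h3, e3⟩ := h φ₁ (dirDeriv v φ₂) g
  have e : (fun z => windowCoeff ħ φ₁ g z *
      (T ∘ₗ (dirDeriv v).toLinearMap) (wignerTest ħ φ₂ z)) = fun z =>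
      windowCoeff ħ φ₁ (dirDeriv v g) z * T (wignerTest ħ φ₂ z) -
      windowCoeff ħ (dirDeriv v φ₁) g z * T (wignerTest ħ φ₂ z) -
      windowCoeff ħ φ₁ g z * T (wignerTest ħ (dirDeriv v φ₂) z) := by
    funext z
    have hz : (T ∘ₗ (dirDeriv v).toLinearMap) (wignerTest ħ φ₂ z) =
        T (dirDeriv v (wignerTest ħ φ₂ z)) := rfl
    rw [hz, dirDeriv_wignerTest, map_sub, map_smul, smul_eq_mul]
    linear_combination -T (wignerTest ħ φ₂ z) * momentum_mul_windowCoeff ħ φ₁ g z v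
  have h12 := h1.sub h2
  rw [e]
  refine ⟨h12.sub h3, ?_⟩
  have hg : (T ∘ₗ (dirDeriv v).toLinearMap) g = T (dirDeriv v g) := rfl
  refine (integral_sub h12 h3).trans ?_
  rw [integral_sub' h1 h2, e1, e2, e3, inner_dirDeriv, hg]
  ring

lemma IsReproduced.comp_weyl {ħ : ℝ} {A : 𝓢(Config n, ℂ) →L[ℂ] 𝓢(Config n, ℂ)}
    (hA : A ∈ weylAlgebra n) {T : 𝓢(Config n, ℂ) →ₗ[ℂ] ℂ} (h : IsReproduced ħ T) :
    IsReproduced ħ (T ∘ₗ A.toLinearMap) := by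
  induction hA using Algebra.adjoin_induction generalizing T with
  | mem A hA =>
    rcases hA with ⟨v, rfl⟩ | ⟨v, rfl⟩
    · exact h.comp_mulInner v
    · exact h.comp_dirDeriv v
  | algebraMap c =>
    have e : T ∘ₗ (algebraMap ℂ (𝓢(Config n, ℂ) →L[ℂ] 𝓢(Config n, ℂ)) c).toLinearMap = c • T := by
      ext g
      rw [Algebra.algebraMap_eq_smul_one]
      exact map_smul T c g
    rw [e]
    exact h.smul c
  | add A B _ _ ihA ihB =>
    have e : T ∘ₗ (A + B).toLinearMap = T ∘ₗ A.toLinearMap + T ∘ₗ B.toLinearMap := by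
      ext g
      exact map_add T (A g) (B g)
    rw [e]
    exact (ihA h).add (ihB h)
  | mul A B _ _ ihA ihB => exact ihB (ihA h)

/-- The function `u ↦ g u * φ (2x - u)` as a Schwartz function. -/
def mulReflected (g φ : 𝓢(Config n, ℂ)) (x : Config n) : 𝓢(Config n, ℂ) :=
  pairing (ContinuousLinearMap.mul ℂ ℂ) g
    (compSubConstCLM ℂ ((2 : ℝ) • x)
      (compCLMOfContinuousLinearEquiv ℂ (ContinuousLinearEquiv.neg ℝ) φ))

lemma mulReflected_apply (g φ : 𝓢(Config n, ℂ)) (x u : Config n) :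
    mulReflected g φ x u = g u * φ ((2 : ℝ) • x - u) := by
  simp [mulReflected]

/-- For fixed `x`, the coefficients are an inverse Fourier transform in the momentum. -/
lemma windowCoeff_eq_fourierInv {ħ : ℝ} (hħ : 0 < ħ) (φ g : 𝓢(Config n, ℂ)) (x p : Config n) :
    windowCoeff ħ φ g (x, p) =
      Complex.exp (-(2 * Complex.I / ħ * ((inner ℝ p x : ℝ) : ℂ))) *
        (𝓕⁻ (mulReflected g φ x) : 𝓢(Config n, ℂ)) ((Real.pi * ħ)⁻¹ • p) := by
  rw [windowCoeff, inner_toL2_toL2_eq _ _ volume, fourierInv_coe, Real.fourierInv_eq',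
    ← integral_const_mul]
  congr 1
  funext u
  rw [RCLike.inner_apply, wignerTest_apply, mulReflected_apply, map_mul, RCLike.conj_conj,
    ← Complex.exp_conj, smul_eq_mul, ← mul_assoc (Complex.exp _), ← Complex.exp_add]
  have hħ' : (ħ : ℂ) ≠ 0 := by exact_mod_cast hħ.ne'
  have hπ : (Real.pi : ℂ) ≠ 0 := by exact_mod_cast Real.pi_ne_zero
  have e : conj (Complex.I * ((-(2 / ħ) * inner ℝ p (u - x) : ℝ) : ℂ)) =
      -(2 * Complex.I / ħ * ((inner ℝ p x : ℝ) : ℂ)) +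
        ((2 * Real.pi * inner ℝ u ((Real.pi * ħ)⁻¹ • p) : ℝ) : ℂ) * Complex.I := by
    rw [map_mul, Complex.conj_I, Complex.conj_ofReal, inner_sub_right, inner_smul_right,
      real_inner_comm]
    push_cast
    field_simp
    ring
  rw [e]
  ring

lemma inner_wignerTest_eq_fourier {ħ : ℝ} (hħ : 0 < ħ) (φ : 𝓢(Config n, ℂ)) (h : L2 n)
    (x p : Config n) :
    inner ℂ h ((wignerTest ħ φ (x, p)).toLp 2) =
      Complex.exp (2 * Complex.I / ħ * ((inner ℝ p x : ℝ) : ℂ)) *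
        𝓕 (fun u => conj (h u) * conj (φ ((2 : ℝ) • x - u))) ((Real.pi * ħ)⁻¹ • p) := by
  rw [L2.inner_def, Real.fourier_eq', ← integral_const_mul]
  refine integral_congr_ae ?_
  filter_upwards [(wignerTest ħ φ (x, p)).coeFn_toLp 2 volume] with u hu
  rw [hu, RCLike.inner_apply, wignerTest_apply, smul_eq_mul, ← mul_assoc (Complex.exp _),
    ← Complex.exp_add]
  have hħ' : (ħ : ℂ) ≠ 0 := by exact_mod_cast hħ.ne'
  have hπ : (Real.pi : ℂ) ≠ 0 := by exact_mod_cast Real.pi_ne_zero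
  have e : Complex.I * ((-(2 / ħ) * inner ℝ p (u - x) : ℝ) : ℂ) =
      2 * Complex.I / ħ * ((inner ℝ p x : ℝ) : ℂ) +
        ((-2 * Real.pi * inner ℝ u ((Real.pi * ħ)⁻¹ • p) : ℝ) : ℂ) * Complex.I := by
    rw [inner_sub_right, inner_smul_right, real_inner_comm]
    push_cast
    field_simp
    ring
  rw [e]
  ring

lemma memLp_conj (h : L2 n) : MemLp (fun u => conj (h u)) 2 volume :=
  (Lp.memLp h).star

/-- Parseval's formula in the momentum variable, for a fixed position `x`. -/
lemma integral_windowCoeff_mul_inner {ħ : ℝ} (hħ : 0 < ħ) (φ₁ φ₂ g : 𝓢(Config n, ℂ)) (h : L2 n)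
    (x : Config n) :
    ∫ p, windowCoeff ħ φ₁ g (x, p) * inner ℂ h ((wignerTest ħ φ₂ (x, p)).toLp 2) =
      ((Real.pi * ħ : ℝ) : ℂ) ^ n * ∫ u, (g u * conj (h u)) *
        (φ₁ ((2 : ℝ) • x - u) * conj (φ₂ ((2 : ℝ) • x - u))) := by
  set a : 𝓢(Config n, ℂ) := 𝓕⁻ (mulReflected g φ₁ x) with ha
  set b : Config n → ℂ := fun u => conj (h u) * conj (φ₂ ((2 : ℝ) • x - u)) with hb
  have hbi : Integrable b := by
    have h1 : MemLp (fun u => conj (φ₂ ((2 : ℝ) • x - u))) 2 volume :=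
      ((φ₂.memLp 2).comp_measurePreserving
        (Measure.measurePreserving_sub_left volume ((2 : ℝ) • x))).star
    exact (memLp_conj h).integrable_mul h1
  have h1 : ∀ p, windowCoeff ħ φ₁ g (x, p) * inner ℂ h ((wignerTest ħ φ₂ (x, p)).toLp 2) =
      (fun q => a q * 𝓕 b q) ((Real.pi * ħ)⁻¹ • p) := fun p => by
    rw [windowCoeff_eq_fourierInv hħ, inner_wignerTest_eq_fourier hħ]
    have := Complex.exp_ne_zero (2 * Complex.I / ħ * ((inner ℝ p x : ℝ) : ℂ))
    rw [Complex.exp_neg]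
    field_simp
    rfl
  simp_rw [h1]
  rw [Measure.integral_comp_inv_smul volume (fun q => a q * 𝓕 b q) (Real.pi * ħ),
    finrank_euclideanSpace_fin, abs_of_pos (by positivity), Complex.real_smul, Complex.ofReal_pow]
  congr 1
  have h2 := VectorFourier.integral_fourierIntegral_smul_eq_flip
    (μ := (volume : Measure (Config n))) (ν := (volume : Measure (Config n)))
    (L := innerₗ (Config n)) Real.continuous_fourierChar
    continuous_inner a.integrable hbi
  rw [flip_innerₗ] at h2
  have h3 : ∀ u, 𝓕 (a : Config n → ℂ) u = g u * φ₁ ((2 : ℝ) • x - u) := fun u => by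
    rw [← fourier_coe, ha, FourierTransform.fourier_fourierInv_eq, mulReflected_apply]
  refine (h2.symm.trans ?_)
  refine integral_congr_ae (Filter.Eventually.of_forall fun u => ?_)
  have h4 := h3 u
  change 𝓕 (a : Config n → ℂ) u • b u = _
  rw [h4, hb, smul_eq_mul]
  ring

/-- Integration over the positions of a product `G u * k (2x - u)`. -/
lemma integral_integral_mul_reflected {G k : Config n → ℂ} (hG : Integrable G) (hk : Integrable k)
    (hkc : Continuous k) :
    ∫ x : Config n, ∫ u, G u * k ((2 : ℝ) • x - u) =
      ((1 / 2 : ℝ) : ℂ) ^ n * (∫ u, k u) * ∫ u, G u := by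
  have hx : ∀ {F : Type} [NormedAddCommGroup F] [NormedSpace ℝ F] (k' : Config n → F)
      (u : Config n), ∫ x : Config n, k' ((2 : ℝ) • x - u) = (1 / 2 : ℝ) ^ n • ∫ v, k' v := by
    intro F _ _ k' u
    rw [Measure.integral_comp_smul volume (fun y => k' (y - u)) 2,
      integral_sub_right_eq_self k' u, finrank_euclideanSpace_fin, abs_of_pos (by positivity)]
    simp
  have hi : Integrable (fun q : Config n × Config n => G q.2 * k ((2 : ℝ) • q.1 - q.2))
      (volume.prod volume) := by
    have hm : AEStronglyMeasurable (fun q : Config n × Config n =>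
        G q.2 * k ((2 : ℝ) • q.1 - q.2)) (volume.prod volume) :=
      hG.1.comp_snd.mul (by fun_prop : Continuous fun q : Config n × Config n =>
        k ((2 : ℝ) • q.1 - q.2)).aestronglyMeasurable
    rw [integrable_prod_iff' hm]
    refine ⟨Filter.Eventually.of_forall fun u => ?_, ?_⟩
    · have h1 : Integrable (fun x : Config n => k (x - u)) := hk.comp_sub_right u
      exact ((h1.comp_smul (two_ne_zero' ℝ)).const_mul (G u) :)
    · simp only [norm_mul, integral_const_mul]
      have h1 : ∀ u, ∫ x : Config n, ‖k ((2 : ℝ) • x - u)‖ = _ := fun u =>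
        hx (fun v => ‖k v‖) u
      simp_rw [h1]
      exact hG.norm.mul_const _
  rw [integral_integral_swap hi]
  simp_rw [integral_const_mul, hx k]
  rw [integral_mul_const, Complex.real_smul, Complex.ofReal_pow]
  ring

lemma integrable_windowCoeff_mul_inner {ħ : ℝ} (hħ : 0 < ħ) (φ₁ φ₂ g : 𝓢(Config n, ℂ)) (h : L2 n) :
    Integrable (fun z => windowCoeff ħ φ₁ g z * inner ℂ h ((wignerTest ħ φ₂ z).toLp 2))
      (volume : Measure (Config n × Config n)) := by
  have hm : ∀ (h : L2 n) (φ : 𝓢(Config n, ℂ)), AEStronglyMeasurable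
      (fun z => inner ℂ h ((wignerTest ħ φ z).toLp 2))
      (volume : Measure (Config n × Config n)) := fun h φ => by
    have h1 : ∀ z, inner ℂ h ((wignerTest ħ φ z).toLp 2) =
        ∫ u, wignerTest ħ φ z u * conj (h u) := fun z => by
      rw [L2.inner_def]
      refine integral_congr_ae ?_
      filter_upwards [(wignerTest ħ φ z).coeFn_toLp 2 volume] with u hu
      rw [hu, RCLike.inner_apply]
    simp_rw [h1]
    exact AEStronglyMeasurable.integral_prod_right'
      (f := fun q : (Config n × Config n) × Config n => wignerTest ħ φ q.1 q.2 * conj (h q.2))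
      ((continuous_wignerTest ħ φ).aestronglyMeasurable.mul (memLp_conj h).1.comp_snd)
  have hV : AEStronglyMeasurable (windowCoeff ħ φ₁ g) (volume : Measure (Config n × Config n)) := by
    have e : windowCoeff ħ φ₁ g = fun z =>
        conj (inner ℂ (g.toLp 2 : L2 n) ((wignerTest ħ φ₁ z).toLp 2)) := by
      funext z
      rw [inner_conj_symm]
      rfl
    rw [e]
    exact (hm _ φ₁).star
  have : (volume : Measure (Config n × Config n)).IsAddHaarMeasure := by
    rw [Measure.volume_eq_prod]
    infer_instance
  obtain ⟨C, hC⟩ := exists_pow_mul_norm_windowCoeff_le hħ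
    (volume : Measure (Config n × Config n)).integrablePower φ₁ g
  have hVi : Integrable (windowCoeff ħ φ₁ g) (volume : Measure (Config n × Config n)) := by
    have h1 := integrable_of_le_of_pow_mul_le (k := 0) (norm_windowCoeff_le ħ φ₁ g)
      (by simpa using hC) hV
    simp only [pow_zero, one_mul] at h1
    exact (integrable_norm_iff hV).1 h1
  refine hVi.mul_bdd (c := ‖h‖ * ‖φ₂.toLp 2‖) (hm h φ₂) (Filter.Eventually.of_forall fun z => ?_)
  rw [← norm_toLp_wignerTest ħ φ₂ z]
  exact norm_inner_le_norm _ _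

/-- Moyal's identity: functionals represented by square-integrable functions are reproduced. -/
lemma isReproduced_inner {ħ : ℝ} (hħ : 0 < ħ) (h : L2 n) :
    IsReproduced ħ ((innerSL ℂ h).comp (toLpCLM ℂ ℂ 2 volume)).toLinearMap := fun φ₁ φ₂ g => by
  have hT : ∀ f : 𝓢(Config n, ℂ), ((innerSL ℂ h).comp (toLpCLM ℂ ℂ 2 volume)).toLinearMap f =
    inner ℂ h (f.toLp 2) := fun f => rfl
  have hi := integrable_windowCoeff_mul_inner hħ φ₁ φ₂ g h
  simp_rw [hT]
  refine ⟨hi, ?_⟩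
  rw [Measure.volume_eq_prod] at hi ⊢
  rw [integral_prod _ hi]
  simp_rw [integral_windowCoeff_mul_inner hħ]
  have hk : Integrable (fun v => φ₁ v * conj (φ₂ v)) := by
    exact (φ₁.memLp 2).integrable_mul (φ₂.memLp 2).star
  rw [integral_const_mul, integral_integral_mul_reflected (G := fun u => g u * conj (h u))
    (k := fun v => φ₁ v * conj (φ₂ v)) ((g.memLp 2).integrable_mul (memLp_conj h)) hk
    (by have := φ₁.continuous; have := φ₂.continuous; fun_prop)]
  have h1 : inner ℂ h (g.toLp 2) = ∫ u, g u * conj (h u) := by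
    rw [L2.inner_def]
    refine integral_congr_ae ?_
    filter_upwards [g.coeFn_toLp 2 volume] with u hu
    rw [hu, RCLike.inner_apply]
  rw [h1, inner_toL2_toL2_eq _ _ volume]
  simp only [RCLike.inner_apply]
  rw [div_eq_mul_one_div (Real.pi * ħ) 2, Complex.ofReal_mul (Real.pi * ħ), mul_pow]
  ring

/-- Every tempered distribution is reproduced. -/
theorem isReproduced {ħ : ℝ} (hħ : 0 < ħ) (ψ : 𝓢'(Config n, ℂ)) :
    IsReproduced ħ (ψ : 𝓢(Config n, ℂ) →ₗ[ℂ] ℂ) := by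
  obtain ⟨m, A, h, hA, hψ⟩ := exists_eq_sum_inner ψ
  have e : (ψ : 𝓢(Config n, ℂ) →ₗ[ℂ] ℂ) = ∑ i,
      ((innerSL ℂ (h i)).comp (toLpCLM ℂ ℂ 2 volume)).toLinearMap ∘ₗ (A i).toLinearMap := by
    ext g
    rw [LinearMap.sum_apply]
    exact hψ g
  rw [e]
  exact IsReproduced.sum _ fun i => (isReproduced_inner hħ (h i)).comp_weyl (hA i)

/-- A tempered distribution that is continuous for the `L²` norm is a square-integrable function. -/
lemma exists_toTemperedDistribution_eq_of_norm_le (ψ : 𝓢'(Config n, ℂ)) (C : ℝ)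
    (h : ∀ g : 𝓢(Config n, ℂ), ‖ψ g‖ ≤ C * ‖g.toLp 2‖) :
    ∃ f : L2 n, Lp.toTemperedDistribution f = ψ := by
  obtain ⟨y, hy⟩ := exists_inner_eq_of_norm_le (H := L2 n) (ψ : 𝓢(Config n, ℂ) →ₗ[ℂ] ℂ)
    (toLpCLM ℂ ℂ 2 volume : 𝓢(Config n, ℂ) →L[ℂ] L2 n).toLinearMap C h
  have hy' : ∀ g : 𝓢(Config n, ℂ), ψ g = inner ℂ y (g.toLp 2) := hy
  refine ⟨(memLp_conj y).toLp _, ?_⟩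
  ext g
  rw [hy', Lp.toTemperedDistribution_apply, L2.inner_def]
  refine integral_congr_ae ?_
  filter_upwards [(memLp_conj y).coeFn_toLp, g.coeFn_toLp 2 volume] with u hu hg
  rw [hu, hg, RCLike.inner_apply, smul_eq_mul]

lemma exists_schwartz_ne_zero (n : ℕ) : ∃ φ : 𝓢(Config n, ℂ), φ ≠ 0 := by
  let b : ContDiffBump (0 : Config n) := ⟨1, 2, one_pos, one_lt_two⟩
  have hb : HasCompactSupport (fun x => (b x : ℂ)) := 
    b.hasCompactSupport.comp_left (g := Complex.ofReal) Complex.ofReal_zero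
  refine ⟨hb.toSchwartzMap (Complex.ofRealCLM.contDiff.comp b.contDiff), fun h => ?_⟩
  have h0 := congrArg (fun f : 𝓢(Config n, ℂ) => f 0) h
  have h1 : (b 0 : ℂ) = 0 := h0
  rw [b.one_of_mem_closedBall (by simp [b])] at h1
  simp at h1

lemma integrable_apply_wignerTest {ħ : ℝ} (hħ : 0 < ħ) {ψ : 𝓢'(Config n, ℂ)}
    (hψ : ψ ∈ feichtingerAlgebra n ħ) {φ : 𝓢(Config n, ℂ)} (hφ : φ ≠ 0) :
    Integrable (fun z => ψ (wignerTest ħ φ z)) (volume : Measure (Config n × Config n)) := by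
  have h1 : crossWigner ħ ψ φ = fun z => (((1 / (2 * Real.pi * ħ) : ℝ) : ℂ) ^ n * 2 ^ n) *
      ψ (wignerTest ħ φ z) := by
    funext z
    rw [crossWigner]
    ring
  have h2 := hψ φ hφ
  rw [h1] at h2
  refine (integrable_const_mul_iff (IsUnit.mk0 _ ?_) _).1 h2
  refine mul_ne_zero (pow_ne_zero _ ?_) (pow_ne_zero _ two_ne_zero)
  exact_mod_cast (by positivity : 0 < 1 / (2 * Real.pi * ħ)).ne'

/-- A tempered distribution in the Feichtinger algebra is a square-integrable function. -/
theorem exists_toTemperedDistribution_eq {ħ : ℝ} (hħ : 0 < ħ) {ψ : 𝓢'(Config n, ℂ)}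
    (hψ : ψ ∈ feichtingerAlgebra n ħ) : ∃ f : L2 n, Lp.toTemperedDistribution f = ψ := by
  obtain ⟨φ, hφ⟩ := exists_schwartz_ne_zero n
  have h0 : ((0 : 𝓢(Config n, ℂ)).toLp 2 : L2 n) = 0 :=
    map_zero (toLpCLM ℂ ℂ 2 volume : 𝓢(Config n, ℂ) →L[ℂ] L2 n)
  have hφ2 : (φ.toLp 2 : L2 n) ≠ 0 := fun h => hφ (injective_toLp 2 volume (h.trans h0.symm))
  have hW := integrable_apply_wignerTest hħ hψ hφ
  set c : ℂ := ((Real.pi * ħ / 2 : ℝ) : ℂ) ^ n * inner ℂ (φ.toLp 2) (φ.toLp 2) with hc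
  have hcp : 0 < ‖c‖ := norm_pos_iff.2 <| mul_ne_zero (pow_ne_zero _ (by
    exact_mod_cast (by positivity : 0 < Real.pi * ħ / 2).ne')) (inner_self_ne_zero.2 hφ2)
  refine exists_toTemperedDistribution_eq_of_norm_le ψ
    (‖c‖⁻¹ * (‖φ.toLp 2‖ * ∫ z, ‖ψ (wignerTest ħ φ z)‖)) fun g => ?_
  have h1 : ∫ z, windowCoeff ħ φ g z * ψ (wignerTest ħ φ z) = c * ψ g :=
    (isReproduced hħ ψ φ φ g).2
  have h2 : ‖c‖ * ‖ψ g‖ ≤ (‖φ.toLp 2‖ * ‖g.toLp 2‖) * ∫ z, ‖ψ (wignerTest ħ φ z)‖ := by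
    rw [← norm_mul, ← h1, ← integral_const_mul]
    refine norm_integral_le_of_norm_le (hW.norm.const_mul _)
      (Filter.Eventually.of_forall fun z => ?_)
    rw [norm_mul]
    exact mul_le_mul_of_nonneg_right (norm_windowCoeff_le ħ φ g z) (norm_nonneg _)
  rw [← le_inv_mul_iff₀ hcp] at h2
  refine h2.trans (le_of_eq ?_)
  ring

/-! ### Phase space reflections and their covariance -/

/-- The reflection of a Schwartz function about the phase space point `z = (x, p)` (the
Grossmann–Royer operator), `φ ↦ exp ((2i/ħ) p·(u - x)) φ (2x - u)`. -/
def phaseReflection (ħ : ℝ) (z : Config n × Config n) (φ : 𝓢(Config n, ℂ)) : 𝓢(Config n, ℂ) :=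
  postcompCLM (𝕜 := ℝ) (Complex.conjCLE : ℂ →L[ℝ] ℂ) (wignerTest ħ φ z)

lemma phaseReflection_apply (ħ : ℝ) (z : Config n × Config n) (φ : 𝓢(Config n, ℂ))
    (u : Config n) : phaseReflection ħ z φ u =
      Complex.exp (Complex.I * ((2 / ħ * inner ℝ z.2 (u - z.1) : ℝ) : ℂ)) *
        φ ((2 : ℝ) • z.1 - u) := by
  have h : phaseReflection ħ z φ u = conj (wignerTest ħ φ z u) := rfl
  rw [h, wignerTest_apply, map_mul, RCLike.conj_conj, ← Complex.exp_conj, map_mul, Complex.conj_I,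
    Complex.conj_ofReal]
  congr 2
  push_cast
  ring

lemma crossWigner_toTemperedDistribution (ħ : ℝ) (f : L2 n) (φ : 𝓢(Config n, ℂ))
    (z : Config n × Config n) : crossWigner ħ (Lp.toTemperedDistribution f) φ z =
      ((1 / (2 * Real.pi * ħ) : ℝ) : ℂ) ^ n *
        (2 ^ n * inner ℂ ((phaseReflection ħ z φ).toLp 2) f) := by
  rw [crossWigner, Lp.toTemperedDistribution_apply, L2.inner_def]
  congr 2
  refine integral_congr_ae ?_
  filter_upwards [(phaseReflection ħ z φ).coeFn_toLp 2 volume] with u hu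
  have h : phaseReflection ħ z φ u = conj (wignerTest ħ φ z u) := rfl
  rw [hu, h, RCLike.inner_apply, RCLike.conj_conj, smul_eq_mul, mul_comm]

/-- A bijection of the Schwartz space is covariant if it intertwines the phase space reflections
along an affine bijection `z ↦ S z + z₀` of phase space. -/
def IsCovariant (ħ : ℝ) (M : 𝓢(Config n, ℂ) ≃ 𝓢(Config n, ℂ)) : Prop :=
  ∃ (S : (Config n × Config n) ≃ₗ[ℝ] (Config n × Config n)) (z₀ : Config n × Config n),
    ∀ z φ, M (phaseReflection ħ z φ) = phaseReflection ħ (S z + z₀) (M φ)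

lemma IsCovariant.refl (ħ : ℝ) : IsCovariant ħ (Equiv.refl 𝓢(Config n, ℂ)) :=
  ⟨LinearEquiv.refl ℝ _, 0, fun z φ => by simp⟩

lemma IsCovariant.trans {ħ : ℝ} {M M' : 𝓢(Config n, ℂ) ≃ 𝓢(Config n, ℂ)} (h : IsCovariant ħ M)
    (h' : IsCovariant ħ M') : IsCovariant ħ (M.trans M') := by
  obtain ⟨S, z₀, h⟩ := h
  obtain ⟨S', z₀', h'⟩ := h'
  refine ⟨S.trans S', S' z₀ + z₀', fun z φ => ?_⟩
  rw [Equiv.trans_apply, h, h', LinearEquiv.trans_apply, map_add, add_assoc]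
  rfl

lemma IsCovariant.symm {ħ : ℝ} {M : 𝓢(Config n, ℂ) ≃ 𝓢(Config n, ℂ)} (h : IsCovariant ħ M) :
    IsCovariant ħ M.symm := by
  obtain ⟨S, z₀, h⟩ := h
  refine ⟨S.symm, -S.symm z₀, fun z φ => ?_⟩
  rw [Equiv.symm_apply_eq, h, Equiv.apply_symm_apply, map_add, map_neg,
    LinearEquiv.apply_symm_apply, LinearEquiv.apply_symm_apply, neg_add_cancel_right]

/-- The bijection `ψ ↦ exp (iθ) ψ` of the Schwartz space. -/
def chirpEquiv {θ : Config n → ℝ} (hθ : θ.HasTemperateGrowth) :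
    𝓢(Config n, ℂ) ≃ 𝓢(Config n, ℂ) where
  toFun := smulLeftCLM ℂ (fun u => Complex.exp (Complex.I * (θ u : ℂ)))
  invFun := smulLeftCLM ℂ (fun u => Complex.exp (Complex.I * ((-θ u : ℝ) : ℂ)))
  left_inv φ := by
    ext u
    rw [smulLeftCLM_apply_apply (hasTemperateGrowth_phase (θ := fun u => -θ u) hθ.neg),
      smulLeftCLM_apply_apply (hasTemperateGrowth_phase hθ), smul_eq_mul, smul_eq_mul, ← mul_assoc,
      ← Complex.exp_add]
    simp
  right_inv φ := by
    ext u
    rw [smulLeftCLM_apply_apply (hasTemperateGrowth_phase hθ),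
      smulLeftCLM_apply_apply (hasTemperateGrowth_phase (θ := fun u => -θ u) hθ.neg),
      smul_eq_mul, smul_eq_mul, ← mul_assoc, ← Complex.exp_add]
    simp

lemma chirpEquiv_apply {θ : Config n → ℝ} (hθ : θ.HasTemperateGrowth) (φ : 𝓢(Config n, ℂ))
    (u : Config n) : chirpEquiv hθ φ u = Complex.exp (Complex.I * (θ u : ℂ)) * φ u :=
  smulLeftCLM_apply_apply (hasTemperateGrowth_phase hθ) _ _

/-- The shear `(x, p) ↦ (x, p + G x)` of phase space. -/
def shearEquiv (G : Config n →ₗ[ℝ] Config n) :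
    (Config n × Config n) ≃ₗ[ℝ] (Config n × Config n) where
  toFun z := (z.1, z.2 + G z.1)
  map_add' z w := by
    ext1
    · rfl
    · simp only [Prod.fst_add, Prod.snd_add, map_add]
      abel
  map_smul' c z := by simp
  invFun z := (z.1, z.2 - G z.1)
  left_inv z := by simp
  right_inv z := by simp

/-- The hypothesis says that `θ` is a polynomial of degree at most two with gradient `G x + b`. -/
lemma isCovariant_chirpEquiv {ħ : ℝ} (hħ : 0 < ħ) {θ : Config n → ℝ} (hθ : θ.HasTemperateGrowth)
    (G : Config n →ₗ[ℝ] Config n) (b : Config n)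
    (h : ∀ x u, θ ((2 : ℝ) • x - u) = θ u - 2 * inner ℝ (G x + b) (u - x)) :
    IsCovariant ħ (chirpEquiv hθ) := by
  refine ⟨shearEquiv (ħ • G), (0, ħ • b), fun z φ => ?_⟩
  ext u
  rw [chirpEquiv_apply, phaseReflection_apply, phaseReflection_apply, chirpEquiv_apply, ← mul_assoc,
    ← mul_assoc, ← Complex.exp_add, ← Complex.exp_add]
  have e1 : (shearEquiv (ħ • G) z + (0, ħ • b)).1 = z.1 := by simp [shearEquiv]
  have e2 : (shearEquiv (ħ • G) z + (0, ħ • b)).2 = z.2 + ħ • (G z.1 + b) := by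
    simp [shearEquiv, add_assoc]
  rw [e1, e2, h, ← mul_add, ← mul_add, ← Complex.ofReal_add, ← Complex.ofReal_add, inner_add_left,
    inner_smul_left]
  congr 4
  have : ħ ≠ 0 := hħ.ne'
  rw [RCLike.conj_to_real]
  field_simp
  ring

/-- The bijection `ψ ↦ ψ (A x)` of the Schwartz space. -/
def dilationEquiv (A : Config n ≃L[ℝ] Config n) : 𝓢(Config n, ℂ) ≃ 𝓢(Config n, ℂ) where
  toFun := compCLMOfContinuousLinearEquiv ℂ A
  invFun := compCLMOfContinuousLinearEquiv ℂ A.symm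
  left_inv φ := by ext u; simp
  right_inv φ := by ext u; simp

lemma dilationEquiv_apply (A : Config n ≃L[ℝ] Config n) (φ : 𝓢(Config n, ℂ)) (u : Config n) :
    dilationEquiv A φ u = φ (A u) := rfl

lemma isCovariant_dilationEquiv (ħ : ℝ) (A : Config n ≃L[ℝ] Config n) :
    IsCovariant ħ (dilationEquiv A) := by
  -- The momenta transform by the transpose of `A`.
  let B : Config n →ₗ[ℝ] Config n := LinearMap.adjoint (A : Config n →ₗ[ℝ] Config n)
  let B' : Config n →ₗ[ℝ] Config n := LinearMap.adjoint (A.symm : Config n →ₗ[ℝ] Config n)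
  have hB : ∀ p v, inner ℝ (B p) v = inner ℝ p (A v) := fun p v =>
    LinearMap.adjoint_inner_left _ _ _
  have hB' : ∀ p v, inner ℝ (B' p) v = inner ℝ p (A.symm v) := fun p v =>
    LinearMap.adjoint_inner_left _ _ _
  let T : Config n ≃ₗ[ℝ] Config n := LinearEquiv.ofLinearMap B B'
    (by ext1 p; exact ext_inner_right ℝ fun v => by simp [hB, hB'])
    (by ext1 p; exact ext_inner_right ℝ fun v => by simp [hB, hB'])
  refine ⟨A.symm.toLinearEquiv.prodCongr T, 0, fun z φ => ?_⟩
  ext u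
  rw [add_zero, dilationEquiv_apply, phaseReflection_apply, phaseReflection_apply,
    dilationEquiv_apply]
  have e1 : (A.symm.toLinearEquiv.prodCongr T z).1 = A.symm z.1 := rfl
  have e2 : (A.symm.toLinearEquiv.prodCongr T z).2 = B z.2 := rfl
  rw [e1, e2, hB, map_sub A, map_sub A, map_smul A, ContinuousLinearEquiv.apply_symm_apply]

/-- The bijection `ψ ↦ ψ (x - a)` of the Schwartz space. -/
def translationEquiv (a : Config n) : 𝓢(Config n, ℂ) ≃ 𝓢(Config n, ℂ) where
  toFun := compSubConstCLM ℂ a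
  invFun := compSubConstCLM ℂ (-a)
  left_inv φ := by ext u; simp
  right_inv φ := by ext u; simp

lemma translationEquiv_apply (a : Config n) (φ : 𝓢(Config n, ℂ)) (u : Config n) :
    translationEquiv a φ u = φ (u - a) := by
  change compSubConstCLM ℂ a φ u = _
  rw [compSubConstCLM_apply]

lemma isCovariant_translationEquiv (ħ : ℝ) (a : Config n) :
    IsCovariant ħ (translationEquiv a) := by
  refine ⟨LinearEquiv.refl ℝ _, (a, 0), fun z φ => ?_⟩
  ext u
  rw [translationEquiv_apply, phaseReflection_apply, phaseReflection_apply, translationEquiv_apply,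
    LinearEquiv.refl_apply, Prod.fst_add, Prod.snd_add, add_zero, smul_add, two_smul ℝ a]
  congr 2
  · rw [sub_sub u, add_comm a]
  · abel

/-- The bijection `ψ ↦ c ψ` of the Schwartz space. -/
def scalarEquiv {c : ℂ} (hc : c ≠ 0) : 𝓢(Config n, ℂ) ≃ 𝓢(Config n, ℂ) where
  toFun φ := c • φ
  invFun φ := c⁻¹ • φ
  left_inv φ := inv_smul_smul₀ hc φ
  right_inv φ := smul_inv_smul₀ hc φ

lemma isCovariant_scalarEquiv (ħ : ℝ) {c : ℂ} (hc : c ≠ 0) :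
    IsCovariant ħ (scalarEquiv (n := n) hc) := by
  refine ⟨LinearEquiv.refl ℝ _, 0, fun z φ => ?_⟩
  ext u
  rw [add_zero, LinearEquiv.refl_apply]
  change c * phaseReflection ħ z φ u = _
  rw [phaseReflection_apply, phaseReflection_apply]
  change _ = _ * (c * _)
  ring

/-- The Fourier transform as a bijection of the Schwartz space. -/
def schwartzFourierEquiv (n : ℕ) : 𝓢(Config n, ℂ) ≃ 𝓢(Config n, ℂ) where
  toFun φ := 𝓕 φ
  invFun φ := 𝓕⁻ φ
  left_inv φ := FourierTransform.fourierInv_fourier_eq φ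
  right_inv φ := FourierTransform.fourier_fourierInv_eq φ

/-- The linear map `(x, p) ↦ (c p, -c⁻¹ x)` of phase space. -/
def scaledRotation {c : ℝ} (hc : c ≠ 0) :
    (Config n × Config n) ≃ₗ[ℝ] (Config n × Config n) where
  toFun z := (c • z.2, -(c⁻¹ • z.1))
  map_add' z w := by
    ext1
    · simp
    · simp only [Prod.fst_add, Prod.snd_add, smul_add, neg_add]
  map_smul' a z := by
    ext1
    · simp [smul_comm c]
    · simp [smul_comm a c⁻¹]
  invFun z := (-(c • z.2), c⁻¹ • z.1)
  left_inv z := by simp [smul_smul, hc]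
  right_inv z := by simp [smul_smul, hc]

lemma isCovariant_schwartzFourierEquiv {ħ : ℝ} (hħ : 0 < ħ) :
    IsCovariant ħ (schwartzFourierEquiv n) := by
  have hc : (2 * Real.pi * ħ)⁻¹ ≠ 0 := by positivity
  refine ⟨scaledRotation hc, 0, fun z φ => ?_⟩
  ext w
  rw [add_zero, phaseReflection_apply]
  change 𝓕 (phaseReflection ħ z φ) w = _ * 𝓕 φ _
  rw [fourier_coe, fourier_coe, Real.fourier_eq', Real.fourier_eq',
    ← integral_sub_left_eq_self _ volume ((2 : ℝ) • z.1), ← integral_const_mul]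
  congr 1
  funext v
  rw [phaseReflection_apply, sub_sub_cancel, smul_eq_mul, smul_eq_mul, ← mul_assoc, ← mul_assoc,
    ← Complex.exp_add, ← Complex.exp_add]
  congr 2
  have e1 : (scaledRotation hc z).1 = (2 * Real.pi * ħ)⁻¹ • z.2 := rfl
  have e2 : (scaledRotation hc z).2 = -(((2 * Real.pi * ħ)⁻¹)⁻¹ • z.1) := rfl
  rw [e1, e2]
  simp only [inner_sub_left, inner_sub_right, inner_smul_left, inner_smul_right, inner_neg_left,
    RCLike.conj_to_real, inv_inv, real_inner_comm z.1 z.2, real_inner_comm v z.2]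
  have hħ' : (ħ : ℂ) ≠ 0 := by exact_mod_cast hħ.ne'
  have hπ : (Real.pi : ℂ) ≠ 0 := by exact_mod_cast Real.pi_ne_zero
  push_cast
  field_simp
  ring

/-! ### Metaplectic and Heisenberg–Weyl operators -/

/-- The unitary operators that restrict to a covariant bijection of the Schwartz space. -/
def covariantGroup (n : ℕ) (ħ : ℝ) : Subgroup (L2 n ≃ₗᵢ[ℂ] L2 n) where
  carrier := {U | ∃ M : 𝓢(Config n, ℂ) ≃ 𝓢(Config n, ℂ), IsCovariant ħ M ∧
    ∀ φ : 𝓢(Config n, ℂ), U (φ.toLp 2) = (M φ).toLp 2}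
  one_mem' := ⟨Equiv.refl _, IsCovariant.refl ħ, fun φ => rfl⟩
  mul_mem' := by
    rintro U V ⟨M, hM, hU⟩ ⟨N, hN, hV⟩
    refine ⟨N.trans M, hN.trans hM, fun φ => ?_⟩
    change U (V _) = _
    rw [hV, hU]
    rfl
  inv_mem' := by
    rintro U ⟨M, hM, hU⟩
    refine ⟨M.symm, hM.symm, fun φ => ?_⟩
    change U.symm _ = _
    rw [LinearIsometryEquiv.symm_apply_eq, hU, Equiv.apply_symm_apply]

lemma mem_covariantGroup_of_ae {ħ : ℝ} {U : L2 n ≃ₗᵢ[ℂ] L2 n}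
    {M : 𝓢(Config n, ℂ) ≃ 𝓢(Config n, ℂ)} (hM : IsCovariant ħ M)
    (h : ∀ φ : 𝓢(Config n, ℂ), U (φ.toLp 2) =ᵐ[volume] M φ) : U ∈ covariantGroup n ħ :=
  ⟨M, hM, fun φ => Lp.ext ((h φ).trans ((M φ).coeFn_toLp 2 volume).symm)⟩

lemma heisenbergWeyl_mem_covariantGroup {ħ : ℝ} (hħ : 0 < ħ) {z₀ : Config n × Config n}
    {U : L2 n ≃ₗᵢ[ℂ] L2 n} (hU : IsHeisenbergWeyl ħ z₀ U) : U ∈ covariantGroup n ħ := by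
  let θ : Config n → ℝ := fun x => ħ⁻¹ * (inner ℝ z₀.2 x - 1 / 2 * inner ℝ z₀.2 z₀.1)
  have hθ : θ.HasTemperateGrowth := by fun_prop
  have h1 : IsCovariant ħ (chirpEquiv hθ) := by
    refine isCovariant_chirpEquiv hħ hθ 0 (ħ⁻¹ • z₀.2) fun x u => ?_
    simp only [θ, LinearMap.zero_apply, zero_add, inner_smul_left, inner_sub_right,
      inner_smul_right, RCLike.conj_to_real]
    ring
  refine mem_covariantGroup_of_ae ((isCovariant_translationEquiv ħ z₀.1).trans h1) fun φ => ?_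
  have hq : ∀ᵐ x : Config n, φ.toLp 2 volume (x - z₀.1) = φ (x - z₀.1) :=
    (measurePreserving_sub_right volume z₀.1).quasiMeasurePreserving.ae_eq_comp
      (φ.coeFn_toLp 2 volume)
  filter_upwards [hU (φ.toLp 2), hq] with x hx hxq
  rw [hx, hxq, Equiv.trans_apply, chirpEquiv_apply, translationEquiv_apply]
  congr 2
  simp only [θ]
  push_cast
  ring

lemma isCovariant_quadraticChirp {ħ : ℝ} (hħ : 0 < ħ) {Q : Matrix (Fin n) (Fin n) ℝ}
    (hQ : Q.IsSymm) :
    IsCovariant ħ (chirpEquiv (quadratic_hasTemperateGrowth Q (1 / (2 * ħ)))) := by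
  refine isCovariant_chirpEquiv hħ _ (ħ⁻¹ • Matrix.toLpLin 2 2 Q) 0 fun x u => ?_
  have hs : (Q *ᵥ u.ofLp) ⬝ᵥ x.ofLp = (Q *ᵥ x.ofLp) ⬝ᵥ u.ofLp := by
    rw [dotProduct_comm, Matrix.dotProduct_mulVec, ← Matrix.mulVec_transpose, hQ.eq]
  have hi : ∀ v : Config n, inner ℝ (Matrix.toLpLin 2 2 Q x) v = (Q *ᵥ x.ofLp) ⬝ᵥ v.ofLp :=
    fun v => by simp [EuclideanSpace.inner_eq_star_dotProduct, dotProduct_comm]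
  rw [add_zero, LinearMap.smul_apply, inner_smul_left, inner_sub_right, hi, hi]
  simp only [WithLp.ofLp_sub, WithLp.ofLp_smul, Matrix.mulVec_sub, Matrix.mulVec_smul,
    sub_dotProduct, dotProduct_sub, smul_dotProduct, dotProduct_smul, hs, RCLike.conj_to_real,
    smul_eq_mul]
  field_simp
  ring

/-- On Schwartz functions a quadratic Fourier transform is the chirp of `Q`, then the Fourier
transform, the dilation by `L/(2πħ)`, the chirp of `P` and a scalar. -/
lemma quadraticFourierTransform_mem_covariantGroup {ħ : ℝ} (hħ : 0 < ħ) {W : GeneratingForm n}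
    {m : ℤ} {U : L2 n ≃ₗᵢ[ℂ] L2 n} (hU : IsQuadraticFourierTransform ħ W m U) :
    U ∈ covariantGroup n ħ := by
  let B : Config n →ₗ[ℝ] Config n := (2 * Real.pi * ħ)⁻¹ • Matrix.toLpLin 2 2 W.L
  have hB0 : LinearMap.det B ≠ 0 := by
    rw [LinearMap.det_smul, LinearMap.det_toLpLin]
    exact mul_ne_zero (by positivity) W.det_L_ne_zero
  let A : Config n ≃L[ℝ] Config n := (B.equivOfDetNeZero hB0).toContinuousLinearEquiv
  have hA : ∀ x, A x = B x := fun x => rfl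
  have hc : ((1 / (2 * Real.pi * Complex.I * ħ)) ^ ((n : ℂ) / 2) *
      (Complex.I ^ m * (Real.sqrt |W.L.det| : ℂ)) : ℂ) ≠ 0 := by
    have h1 : (1 / (2 * Real.pi * Complex.I * ħ) : ℂ) ≠ 0 := by
      simp [Real.pi_ne_zero, hħ.ne']
    refine mul_ne_zero ?_ (mul_ne_zero (zpow_ne_zero _ Complex.I_ne_zero) ?_)
    · rw [Complex.cpow_def_of_ne_zero h1]
      exact Complex.exp_ne_zero _
    · exact_mod_cast (Real.sqrt_pos.2 (abs_pos.2 W.det_L_ne_zero)).ne'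
  refine mem_covariantGroup_of_ae
    (((isCovariant_quadraticChirp hħ W.symm_Q).trans (isCovariant_schwartzFourierEquiv hħ)).trans
      ((isCovariant_dilationEquiv ħ A).trans ((isCovariant_quadraticChirp hħ W.symm_P).trans
        (isCovariant_scalarEquiv ħ hc)))) fun ψ => ?_
  filter_upwards [hU ψ] with x hx
  rw [hx, quadraticFourierIntegral]
  change _ = _ * chirpEquiv _ _ x
  rw [chirpEquiv_apply, dilationEquiv_apply]
  change _ = _ * (_ * 𝓕 (chirpEquiv _ ψ) (A x))
  rw [fourier_coe, Real.fourier_eq']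
  congr 1
  rw [← integral_const_mul]
  congr 1
  funext y
  rw [chirpEquiv_apply, smul_eq_mul, ← mul_assoc, ← mul_assoc, ← Complex.exp_add,
    ← Complex.exp_add]
  congr 2
  have h5 : inner ℝ y (A x) = (2 * Real.pi * ħ)⁻¹ * ((W.L *ᵥ x.ofLp) ⬝ᵥ y.ofLp) := by
    rw [hA]
    simp [B, inner_smul_right, EuclideanSpace.inner_eq_star_dotProduct]
  rw [h5, GeneratingForm.eval]
  have hħc : (ħ : ℂ) ≠ 0 := by exact_mod_cast hħ.ne'
  have hπ : (Real.pi : ℂ) ≠ 0 := by exact_mod_cast Real.pi_ne_zero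
  push_cast
  field_simp
  ring

theorem inhomogeneousMetaplecticGroup_le_covariantGroup {ħ : ℝ} (hħ : 0 < ħ) :
    inhomogeneousMetaplecticGroup n ħ ≤ covariantGroup n ħ := by
  refine (Subgroup.closure_le _).2 (Set.union_subset ?_ ?_)
  · refine (Subgroup.closure_le _).2 ?_
    rintro U ⟨W, m, -, hU⟩
    exact quadraticFourierTransform_mem_covariantGroup hħ hU
  · rintro U ⟨z₀, hU⟩
    exact heisenbergWeyl_mem_covariantGroup hħ hU

lemma integrable_comp_affine {F : Config n × Config n → ℂ} (hF : Integrable F)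
    (S : (Config n × Config n) ≃ₗ[ℝ] (Config n × Config n)) (z₀ : Config n × Config n) :
    Integrable (fun z => F (S z + z₀)) := by
  have : (volume : Measure (Config n × Config n)).IsAddHaarMeasure := by
    rw [Measure.volume_eq_prod]
    infer_instance
  have hF' : Integrable (fun z => F (z + z₀)) := hF.comp_add_right z₀
  have hm := Measure.map_linearMap_addHaar_eq_smul_addHaar
    (volume : Measure (Config n × Config n)) (f := S.toLinearMap)
    (LinearEquiv.isUnit_det' S).ne_zero
  have hF'' : Integrable (fun z => F (z + z₀)) (Measure.map S.toLinearMap volume) := by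
    rw [hm]
    exact hF'.smul_measure ENNReal.ofReal_ne_top
  exact hF''.comp_measurable S.toLinearMap.continuous_of_finiteDimensional.measurable

/-- Covariant unitary operators preserve the Feichtinger algebra: `W(Uf, φ)` is the composition of
`W(f, U⁻¹φ)` with an affine bijection of phase space. -/
theorem toTemperedDistribution_mem_of_mem_covariantGroup {ħ : ℝ} {U : L2 n ≃ₗᵢ[ℂ] L2 n}
    (hU : U ∈ covariantGroup n ħ) {f : L2 n}
    (hf : Lp.toTemperedDistribution f ∈ feichtingerAlgebra n ħ) :
    Lp.toTemperedDistribution (U f) ∈ feichtingerAlgebra n ħ := by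
  intro φ hφ
  obtain ⟨M, ⟨S, z₀, hS⟩, hV⟩ := inv_mem hU
  have hM : M φ ≠ 0 := fun h0 => hφ <| by
    have h1 := hV φ
    have h2 : ((0 : 𝓢(Config n, ℂ)).toLp 2 : L2 n) = 0 :=
      map_zero (toLpCLM ℂ ℂ 2 volume : 𝓢(Config n, ℂ) →L[ℂ] L2 n)
    rw [h0, h2, map_eq_zero_iff _ (U⁻¹).injective] at h1
    exact injective_toLp 2 volume (h1.trans h2.symm)
  have h : crossWigner ħ (Lp.toTemperedDistribution (U f)) φ =
      fun z => crossWigner ħ (Lp.toTemperedDistribution f) (M φ) (S z + z₀) := by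
    funext z
    rw [crossWigner_toTemperedDistribution, crossWigner_toTemperedDistribution, ← hS, ← hV]
    congr 2
    have h1 := (U⁻¹).inner_map_map ((phaseReflection ħ z φ).toLp 2) (U f)
    have h2 : U⁻¹ (U f) = f := U.symm_apply_apply f
    rw [h2] at h1
    exact h1.symm
  rw [h]
  exact integrable_comp_affine (hf (M φ) hM) S z₀

end Feichtinger

end

theorem proposition8 (n : ℕ) (ħ : ℝ) (hħ : 0 < ħ) :
    (∀ ψ ∈ Feichtinger.feichtingerAlgebra n ħ,
      ∃ f : Feichtinger.L2 n, Lp.toTemperedDistribution f = ψ) ∧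
    ∀ U ∈ Feichtinger.inhomogeneousMetaplecticGroup n ħ, ∀ f : Feichtinger.L2 n,
      Lp.toTemperedDistribution f ∈ Feichtinger.feichtingerAlgebra n ħ →
        Lp.toTemperedDistribution (U f) ∈ Feichtinger.feichtingerAlgebra n ħ := by
  refine ⟨fun ψ hψ => Feichtinger.exists_toTemperedDistribution_eq hħ hψ, fun U hU f hf => ?_⟩
  exact Feichtinger.toTemperedDistribution_mem_of_mem_covariantGroup
    (Feichtinger.inhomogeneousMetaplecticGroup_le_covariantGroup hħ hU) hf
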